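/- Let $\sigma:[0,1]\to\mathbb R$ (the total cross-section) be piecewise Hölder continuous: there are a partition $0=c_1<\dots<c_{\aleph}=1$ ($\aleph\ge 2$) and $\eta\in(0,1]$ such that $\sigma$ is Hölder continuous with exponent $\eta$ on each $(c_j,c_{j+1})$, the value $\sigma(c_j)$ being the limit from the right for $j<\aleph$ and the limit from the left for $j=\aleph$. Assume that $\sigma_{\min}:=\inf_{x\in[0,1]}\sigma(x)>0$. Put $\tau(x,y)=\int_x^y\sigma(s)\,ds$ and, for $g\in L_\infty=L_\infty[0,1]$ and $x\in[0,1]$, $$\mathcal S_\mu g(x)=\begin{cases}\mu^{-1}\int_0^x e^{\mu^{-1}\tau(x,y)}g(y)\,dy,&\mu>0,\\ \sigma(x)^{-1}g(x),&\mu=0,\\ -\mu^{-1}\int_x^1 e^{\mu^{-1}\tau(x,y)}g(y)\,dy,&\mu<0,\end{cases}\qquad \mathcal K g(x)=\frac12\int_{-1}^1\mathcal S_\mu g(x)\,d\mu .$$ For $N\ge1$ let $\mu_1,\dots,\mu_N$ and $w_1,\dots,w_N$ be the nodes and weights of the $N$-point Gauss–Legendre rule on $[0,1]$, let $\mu_{-k}=-\mu_k$,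 $w_{-k}=w_k$ (the double Gauss rule on $[-1,1]$), and put $$\mathcal K^N g(x)=\frac12\sum_{|k|=1}^N w_k\,\mathcal S_{\mu_k}g(x).$$ Then $\mathcal K$ and $\mathcal K^N$ are bounded linear operators from $L_\infty$ to $\mathrm C=\mathrm C[0,1]$ (with the supremum norm), and $$\|\mathcal K-\mathcal K^N\|_{L_\infty\to \mathrm C}\le c\,\sigma_{\min}^{-1}N^{-1},$$ where $c>0$ is an absolute constant, independent of $\sigma$ (hence also of the partition and of $\eta$) and of $N$. -/

import Mathlib

open MeasureTheory Set Filter Topology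
open scoped NNReal ENNReal

namespace SlabTransport

noncomputable section

/-- A partition `0 = c₀ < c₁ < ⋯ < cₙ = 1` of the unit interval into `n` subintervals
(the two end conditions force `1 ≤ n`). -/
structure IsPartition {n : ℕ} (c : Fin (n + 1) → ℝ) : Prop where
  strictMono : StrictMono c
  left : c 0 = 0
  right : c (Fin.last n) = 1

/-- `g` belongs to the space of piecewise Hölder continuous functions with exponent `η` with
respect to the partition `c`: it is Hölder continuous on every open subinterval, and its value at
a break point is the limit from the right, except at the last one, where it is the limit
from the left. (On a bounded interval a Hölder continuous function is automatically bounded.) -/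
structure PiecewiseHolder {n : ℕ} (c : Fin (n + 1) → ℝ) (η : ℝ≥0) (g : ℝ → ℝ) : Prop where
  holder : ∀ j : Fin n, ∃ C : ℝ≥0, HolderOnWith C η g (Ioo (c j.castSucc) (c j.succ))
  right_limit : ∀ j : Fin n, Tendsto g (𝓝[>] (c j.castSucc)) (𝓝 (g (c j.castSucc)))
  left_limit : Tendsto g (𝓝[<] (c (Fin.last n))) (𝓝 (g (c (Fin.last n))))

/-- `σ_min`, the infimum of `σ` over `[0,1]`. -/
def sigmaMin (σ : ℝ → ℝ) : ℝ := sInf (σ '' Icc 0 1)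

/-- The (signed) optical path `τ(x,y) = ∫_x^y σ(s) ds`. -/
def tau (σ : ℝ → ℝ) (x y : ℝ) : ℝ := ∫ s in x..y, σ s

/-- The solution operator `S_μ` of the pure transport problem `μ u' + σ u = g` with zero
incoming flux: `u(0) = 0` if `μ > 0` and `u(1) = 0` if `μ < 0`. -/
def solOp (σ : ℝ → ℝ) (μ : ℝ) (g : ℝ → ℝ) (x : ℝ) : ℝ :=
  if 0 < μ then μ⁻¹ * ∫ y in (0 : ℝ)..x, Real.exp (μ⁻¹ * tau σ x y) * g y
  else if μ = 0 then (σ x)⁻¹ * g x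
  else -μ⁻¹ * ∫ y in x..(1 : ℝ), Real.exp (μ⁻¹ * tau σ x y) * g y

/-- The angular average `K g(x) = ½ ∫_{-1}^1 S_μ g(x) dμ`. -/
def avgOp (σ : ℝ → ℝ) (g : ℝ → ℝ) (x : ℝ) : ℝ :=
  1 / 2 * ∫ μ in (-1 : ℝ)..1, solOp σ μ g x

/-- The nodes of the `N`-point Gauss–Legendre rule on `[0,1]`: the roots of the Legendre
polynomial of degree `N` shifted to `[0,1]`. -/
def gaussNodes (N : ℕ) : Finset ℝ :=
  ((Polynomial.shiftedLegendre N).map (Int.castRingHom ℝ)).roots.toFinset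

/-- The weight of the `N`-point Gauss–Legendre rule on `[0,1]` at the node `t`: the integral over
`[0,1]` of the Lagrange basis polynomial which is `1` at `t` and `0` at the other nodes. -/
def gaussWeight (N : ℕ) (t : ℝ) : ℝ :=
  ∫ s in (0 : ℝ)..1, (Lagrange.basis (gaussNodes N) id t).eval s

/-- The `2N` nodes of the double Gauss rule on `[-1,1]`: those of the `N`-point Gauss–Legendre
rule on `[0,1]` and their negatives, which are those of the rule on `[-1,0]`. -/
def doubleGaussNodes (N : ℕ) : Finset ℝ :=
  gaussNodes N ∪ (gaussNodes N).image (fun t => -t)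

/-- The weights of the double Gauss rule; opposite nodes have the same weight. -/
def doubleGaussWeight (N : ℕ) (t : ℝ) : ℝ := gaussWeight N |t|

/-- The angular quadrature `K^N g(x) = ½ ∑_k w_k S_{μ_k} g(x)` with the double Gauss rule. -/
def quadOp (σ : ℝ → ℝ) (N : ℕ) (g : ℝ → ℝ) (x : ℝ) : ℝ :=
  1 / 2 * ∑ t ∈ doubleGaussNodes N, doubleGaussWeight N t * solOp σ t g x

/-- The space `L_∞` of the unit interval. -/
abbrev LInf : Type := Lp ℝ ∞ ((volume : Measure ℝ).restrict (Icc 0 1))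

end

end SlabTransport

namespace SlabTransport

/-! Fix `g` and `x`. For each sign of the direction, the values of the solution operator form a
function H of the modulus u of the direction cosine, u in (0,1]. No smoothness of H uniform up to u
= 0 is available, but H satisfies a scale-invariant bound: |H u - H v| max(u,v) ≤ A |u - v| with A =
2‖g‖/σ_min (`LogLipschitz`, `OpticalPath.logLipschitz_rayOp`). It holds because the kernel u⁻¹
e^{-T/u} has mass at most 1 against σ dy; σ enters only through its optical path and its lower
bound, so the constants are absolute.

Under u = sin²(θ/2) the bound becomes a Lipschitz estimate in θ with constant of order A/√u.
Convolution with a nonnegative trigonometric kernel of degree below 2N and first moment O(1/N) then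
yields a polynomial of degree below 2N with error 2A/(N√u) at u (`LogLipschitz.exists_poly`).

The Gauss rule integrates this polynomial exactly and has nonnegative weights, so its error is at
most the integral plus the Gauss sum of 2A/(N√u). The integral of u^{-1/2} is 2, and the Gauss sum
is no larger: u^{-1/2} is a superposition of functions 1/(u+a), each of which the rule
underestimates (`gauss_inv_sqrt_le`). Hence the error is at most 8A/N (`LogLipschitz.gauss_error`).
The two signs are averaged with factor 1/2, which gives c = 16. -/

/-! ### Gauss–Legendre quadrature: nodes, exactness, positive weights. -/

open Polynomial in
theorem intervalIntegrable_eval_mul_eval (p q : ℝ[X]) {a b : ℝ} :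
    IntervalIntegrable (fun s => p.eval s * q.eval s) volume a b :=
  (p.continuous.mul q.continuous).intervalIntegrable _ _

open Polynomial in
/-- Repeated integration by parts on `[0,1]` for polynomials, the boundary terms vanishing. -/
theorem integral_iterate_derivative_mul (W : ℝ[X]) (k : ℕ)
    (hW : ∀ j < k, (derivative^[j] W).eval 0 = 0 ∧ (derivative^[j] W).eval 1 = 0) (q : ℝ[X]) :
    ∫ s in (0 : ℝ)..1, (derivative^[k] W).eval s * q.eval s =
      (-1) ^ k * ∫ s in (0 : ℝ)..1, W.eval s * (derivative^[k] q).eval s := by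
  induction k generalizing q with
  | zero => simp
  | succ k ih =>
    have h := intervalIntegral.integral_deriv_mul_eq_sub (a := (0 : ℝ)) (b := 1)
      (u := fun s => (derivative^[k] W).eval s) (v := fun s => q.eval s)
      (u' := fun s => (derivative (derivative^[k] W)).eval s)
      (v' := fun s => (derivative q).eval s)
      (fun s _ => Polynomial.hasDerivAt _ _) (fun s _ => Polynomial.hasDerivAt _ _)
      ((Polynomial.continuous _).intervalIntegrable _ _)
      ((Polynomial.continuous _).intervalIntegrable _ _)
    rw [intervalIntegral.integral_add (intervalIntegrable_eval_mul_eval _ _)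
      (intervalIntegrable_eval_mul_eval _ _),
      (hW k k.lt_succ_self).1, (hW k k.lt_succ_self).2,
      ih (fun j hj => hW j (hj.trans k.lt_succ_self))] at h
    rw [Function.iterate_succ_apply', Function.iterate_succ_apply]
    rw [pow_succ]
    linarith

open Polynomial in
/-- The shifted Legendre polynomial with real coefficients. -/
noncomputable def legendre (N : ℕ) : ℝ[X] := (shiftedLegendre N).map (Int.castRingHom ℝ)

open Polynomial in
theorem natDegree_legendre (N : ℕ) : (legendre N).natDegree = N := by
  rw [legendre, natDegree_map_eq_of_injective (RingHom.injective_int _), natDegree_shiftedLegendre]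

open Polynomial in
theorem legendre_ne_zero (N : ℕ) : legendre N ≠ 0 := by
  rw [legendre, Polynomial.map_ne_zero_iff (RingHom.injective_int _)]
  intro h
  simpa [h] using degree_shiftedLegendre N

open Polynomial in
theorem factorial_mul_legendre (N : ℕ) :
    (N.factorial : ℝ[X]) * legendre N = derivative^[N] (X ^ N * (1 - X) ^ N) := by
  have h := congrArg (Polynomial.map (Int.castRingHom ℝ)) (factorial_mul_shiftedLegendre_eq N)
  simpa [← iterate_derivative_map, legendre] using h

open Polynomial in
/-- The shifted Legendre polynomial is orthogonal to all polynomials of smaller degree. -/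
theorem integral_legendre_mul (N : ℕ) (q : ℝ[X]) (hq : q.natDegree < N) :
    ∫ s in (0 : ℝ)..1, (legendre N).eval s * q.eval s = 0 := by
  have hN : (N.factorial : ℝ) ≠ 0 := by exact_mod_cast N.factorial_ne_zero
  -- Rodrigues' formula: a derivative of order j < N of X^N (1-X)^N keeps a factor X^(N-j) and a
  -- factor (1-X)^(N-j), so all boundary terms vanish.
  have h := integral_iterate_derivative_mul (X ^ N * (1 - X) ^ N) N (fun j hj => by
    constructor
    · have h1 : (X : ℝ[X]) ^ (N - j) ∣ derivative^[j] (X ^ N * (1 - X) ^ N) :=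
        pow_sub_dvd_iterate_derivative_of_pow_dvd j (Dvd.intro _ rfl)
      obtain ⟨r, hr⟩ := h1
      rw [hr]
      simp [Nat.sub_ne_zero_of_lt hj]
    · have h1 : (1 - X : ℝ[X]) ^ (N - j) ∣ derivative^[j] (X ^ N * (1 - X) ^ N) :=
        pow_sub_dvd_iterate_derivative_of_pow_dvd j (Dvd.intro_left _ rfl)
      obtain ⟨r, hr⟩ := h1
      rw [hr]
      simp [Nat.sub_ne_zero_of_lt hj]) q
  rw [iterate_derivative_eq_zero hq, ← factorial_mul_legendre] at h
  simp only [eval_mul, eval_natCast, mul_assoc, eval_zero, mul_zero,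
    intervalIntegral.integral_const_mul, intervalIntegral.integral_zero] at h
  exact (mul_eq_zero.mp h).resolve_left hN

open Polynomial in
theorem mem_gaussNodes {N : ℕ} {r : ℝ} : r ∈ gaussNodes N ↔ (legendre N).eval r = 0 := by
  rw [gaussNodes, Multiset.mem_toFinset]
  exact mem_roots (legendre_ne_zero N)

open Polynomial in
/-- A polynomial acquires a constant sign on `(0,1)` after multiplication by linear factors
belonging to distinct roots in `(0,1)` (those of odd multiplicity). -/
theorem exists_finset_const_sign (n : ℕ) (p : ℝ[X]) (hp : p ≠ 0) (hn : p.natDegree = n) :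
    ∃ S : Finset ℝ, (∀ r ∈ S, r ∈ Ioo (0 : ℝ) 1 ∧ p.eval r = 0) ∧
      ((∀ s ∈ Ioo (0 : ℝ) 1, 0 ≤ p.eval s * ∏ r ∈ S, (s - r)) ∨
        (∀ s ∈ Ioo (0 : ℝ) 1, p.eval s * ∏ r ∈ S, (s - r) ≤ 0)) := by
  classical
  induction n generalizing p with
  | zero =>
    refine ⟨∅, by simp, ?_⟩
    rw [eq_C_of_natDegree_eq_zero hn]
    rcases le_total 0 (p.coeff 0) with h | h
    · left; intro s _; simpa using h
    · right; intro s _; simpa using h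
  | succ n ih =>
    by_cases hr : ∃ r ∈ Ioo (0 : ℝ) 1, p.eval r = 0
    · obtain ⟨r, hr01, hr⟩ := hr
      obtain ⟨q, rfl⟩ := dvd_iff_isRoot.mpr hr
      have hq : q ≠ 0 := right_ne_zero_of_mul hp
      have hqn : q.natDegree = n := by
        rw [natDegree_mul (X_sub_C_ne_zero r) hq, natDegree_X_sub_C] at hn
        omega
      obtain ⟨S, hS, hsign⟩ := ih q hq hqn
      -- Membership of `r` is toggled, so that `S` tracks the parity of the multiplicity; the signed
      -- product is then unchanged or gains the square (s - r)².
      by_cases hrS : r ∈ S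
      · refine ⟨S.erase r, fun t ht => ⟨(hS t (Finset.mem_of_mem_erase ht)).1, by
          simp [(hS t (Finset.mem_of_mem_erase ht)).2]⟩, ?_⟩
        have key : ∀ s : ℝ, ((X - C r) * q).eval s * ∏ t ∈ S.erase r, (s - t) =
            q.eval s * ∏ t ∈ S, (s - t) := by
          intro s
          rw [← Finset.mul_prod_erase S _ hrS]
          simp only [eval_mul, eval_sub, eval_X, eval_C]
          ring
        simpa only [key] using hsign
      · refine ⟨insert r S, ?_, ?_⟩
        · intro t ht
          rcases Finset.mem_insert.mp ht with rfl | ht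
          · exact ⟨hr01, hr⟩
          · exact ⟨(hS t ht).1, by simp [(hS t ht).2]⟩
        · have key : ∀ s : ℝ, ((X - C r) * q).eval s * ∏ t ∈ insert r S, (s - t) =
              (s - r) ^ 2 * (q.eval s * ∏ t ∈ S, (s - t)) := by
            intro s
            rw [Finset.prod_insert hrS]
            simp only [eval_mul, eval_sub, eval_X, eval_C]
            ring
          simp only [key]
          rcases hsign with h | h
          · left; intro s hs; exact mul_nonneg (sq_nonneg _) (h s hs)
          · right; intro s hs; exact mul_nonpos_of_nonneg_of_nonpos (sq_nonneg _) (h s hs)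
    · push Not at hr
      refine ⟨∅, by simp, ?_⟩
      simp only [Finset.prod_empty, mul_one]
      by_contra hcon
      push Not at hcon
      obtain ⟨⟨a, ha, ha'⟩, b, hb, hb'⟩ := hcon
      obtain ⟨c, hc, hc'⟩ := (isPreconnected_Ioo (a := (0 : ℝ)) (b := 1)).intermediate_value
        ha hb (p.continuous.continuousOn) (show (0 : ℝ) ∈ Icc _ _ from ⟨ha'.le, hb'.le⟩)
      exact hr c hc hc'

open Polynomial in
theorem eq_zero_of_integral_eq_zero (p : ℝ[X]) (h0 : ∫ s in (0 : ℝ)..1, p.eval s = 0)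
    (hp : ∀ s ∈ Ioo (0 : ℝ) 1, 0 ≤ p.eval s) : p = 0 := by
  by_contra hne
  have hfin : (p.roots.toFinset : Set ℝ).Finite := Finset.finite_toSet _
  obtain ⟨c, hc, hcr⟩ := ((Ioo_infinite (zero_lt_one' ℝ)).sdiff hfin).nonempty
  have hcpos : 0 < p.eval c := by
    refine lt_of_le_of_ne (hp c hc) fun h => hcr ?_
    simp [hne, IsRoot, ← h]
  have hnn : ∀ s ∈ Icc (0 : ℝ) 1, 0 ≤ p.eval s := by
    have hcl : IsClosed {s : ℝ | 0 ≤ p.eval s} := isClosed_le continuous_const p.continuous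
    have := hcl.closure_subset_iff.mpr (fun s hs => hp s hs : Ioo (0 : ℝ) 1 ⊆ _)
    rwa [closure_Ioo (zero_ne_one' ℝ)] at this
  have := intervalIntegral.integral_pos (zero_lt_one' ℝ) p.continuous.continuousOn
    (fun s hs => hnn s (Ioc_subset_Icc_self hs)) ⟨c, Ioo_subset_Icc_self hc, hcpos⟩
  exact this.ne' h0

open Polynomial in
/-- The Gauss nodes are `N` distinct points of `(0,1)`. -/
theorem gaussNodes_spec (N : ℕ) : (∀ r ∈ gaussNodes N, r ∈ Ioo (0 : ℝ) 1) ∧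
    (gaussNodes N).card = N := by
  obtain ⟨S, hS, hsign⟩ := exists_finset_const_sign _ _ (legendre_ne_zero N) rfl
  have hsub : S ⊆ gaussNodes N := by
    intro r hr
    exact mem_gaussNodes.mpr (hS r hr).2
  have hcard : (gaussNodes N).card ≤ N := by
    calc _ ≤ _ := Multiset.toFinset_card_le _
      _ ≤ _ := card_roots' _
      _ = N := natDegree_legendre N
  -- With fewer than N sign changes, the product of the Legendre polynomial and `q` would have
  -- constant sign on (0,1), yet integral zero by orthogonality.
  have hSN : N ≤ S.card := by
    by_contra hlt
    push Not at hlt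
    set q : ℝ[X] := ∏ r ∈ S, (X - C r)
    have hqe : ∀ s, q.eval s = ∏ r ∈ S, (s - r) := fun s => by simp [q, eval_prod]
    have hqd : q.natDegree = S.card := natDegree_finsetProd_X_sub_C_eq_card S id
    have hq0 : q ≠ 0 := (monic_prod_of_monic _ _ fun r _ => monic_X_sub_C r).ne_zero
    have h0 := integral_legendre_mul N q (hqd ▸ hlt)
    have hne : legendre N * q ≠ 0 := mul_ne_zero (legendre_ne_zero N) hq0
    rcases hsign with h | h
    · exact hne (eq_zero_of_integral_eq_zero _ (by simpa using h0)
        fun s hs => by simpa [hqe] using h s hs)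
    · exact neg_ne_zero.mpr hne (eq_zero_of_integral_eq_zero _ (by simpa using h0)
        fun s hs => by simpa [hqe] using h s hs)
  have heq : S = gaussNodes N := Finset.eq_of_subset_of_card_le hsub (hcard.trans hSN)
  exact ⟨fun r hr => (hS r (heq ▸ hr)).1, le_antisymm hcard (heq ▸ hSN)⟩

open Polynomial in
/-- The `N`-point Gauss rule is exact for polynomials of degree less than `2N`. -/
theorem gauss_exact {N : ℕ} (f : ℝ[X]) (hf : f.natDegree < 2 * N) :
    ∑ t ∈ gaussNodes N, gaussWeight N t * f.eval t = ∫ s in (0 : ℝ)..1, f.eval s := by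
  classical
  have hN : 0 < N := by omega
  set P := legendre N with hP
  have hPdeg : P.natDegree = N := natDegree_legendre N
  have hP0 : P ≠ 0 := legendre_ne_zero N
  have hfd : P * (f / P) + f % P = f := EuclideanDomain.div_add_mod f P
  have hr : (f % P).degree < (N : ℕ) := by
    have := EuclideanDomain.mod_lt f hP0
    rw [← hPdeg, ← degree_eq_natDegree hP0]
    exact this
  have hq : (f / P).natDegree < N := by
    by_cases hfP : P.degree ≤ f.degree
    · have hf0 : f ≠ 0 := by
        rintro rfl
        simp [hP0] at hfP
      have h := degree_add_div hP0 hfP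
      have hq0 : f / P ≠ 0 := by
        intro h0
        rw [h0, degree_zero, WithBot.add_bot] at h
        exact hf0 (degree_eq_bot.mp h.symm)
      rw [degree_eq_natDegree hP0, degree_eq_natDegree hq0, degree_eq_natDegree hf0] at h
      norm_cast at h
      omega
    · rw [(Polynomial.div_eq_zero_iff hP0).mpr (not_le.mp hfP), natDegree_zero]
      exact hN
  have hcard := (gaussNodes_spec N).2
  have hint := Lagrange.eq_interpolate (s := gaussNodes N) (v := id) (f := f % P)
    (fun _ _ _ _ h => h) (by rw [hcard]; exact hr)
  -- The multiple of `P` vanishes at the nodes, and its integral vanishes by orthogonality; only the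
  -- remainder, which is its own interpolant, counts.
  have hev : ∀ t ∈ gaussNodes N, f.eval t = (f % P).eval t := by
    intro t ht
    conv_lhs => rw [← hfd]
    simp [hP, mem_gaussNodes.mp ht]
  calc ∑ t ∈ gaussNodes N, gaussWeight N t * f.eval t
      = ∑ t ∈ gaussNodes N, ∫ s in (0 : ℝ)..1,
          (f % P).eval t * (Lagrange.basis (gaussNodes N) id t).eval s := by
        refine Finset.sum_congr rfl fun t ht => ?_
        rw [hev t ht, gaussWeight, intervalIntegral.integral_const_mul, mul_comm]
    _ = ∫ s in (0 : ℝ)..1, ∑ t ∈ gaussNodes N,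
          (f % P).eval t * (Lagrange.basis (gaussNodes N) id t).eval s := by
        rw [intervalIntegral.integral_finsetSum]
        intro t _
        exact (continuous_const.mul (Polynomial.continuous _)).intervalIntegrable _ _
    _ = ∫ s in (0 : ℝ)..1, (f % P).eval s := by
        refine intervalIntegral.integral_congr fun s _ => ?_
        conv_rhs => rw [hint]
        simp [Lagrange.interpolate_apply, eval_finsetSum]
    _ = (∫ s in (0 : ℝ)..1, P.eval s * (f / P).eval s) + ∫ s in (0 : ℝ)..1, (f % P).eval s := by
        rw [hP, integral_legendre_mul N _ hq, zero_add]
    _ = ∫ s in (0 : ℝ)..1, f.eval s := by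
        rw [← intervalIntegral.integral_add (intervalIntegrable_eval_mul_eval _ _)
          ((Polynomial.continuous _).intervalIntegrable _ _)]
        refine intervalIntegral.integral_congr fun s _ => ?_
        conv_rhs => rw [← hfd]
        simp

-- The square of the Lagrange basis polynomial has degree 2N - 2, so the rule is exact for it; the
-- sum reduces to the weight at `t`, which is thus the integral of a square.
open Polynomial in
theorem gaussWeight_nonneg {N : ℕ} {t : ℝ} (ht : t ∈ gaussNodes N) : 0 ≤ gaussWeight N t := by
  classical
  have hN : 0 < N := (gaussNodes_spec N).2 ▸ Finset.card_pos.mpr ⟨t, ht⟩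
  set l := Lagrange.basis (gaussNodes N) id t
  have hl : (l ^ 2).natDegree < 2 * N := by
    rw [natDegree_pow, Lagrange.natDegree_basis (v := id) (fun _ _ _ _ h => h) ht,
      (gaussNodes_spec N).2]
    omega
  have h := gauss_exact _ hl
  rw [Finset.sum_eq_single t] at h
  · have h1 : l.eval t = 1 := Lagrange.eval_basis_self (v := id) (fun _ _ _ _ h => h) ht
    rw [eval_pow, h1, one_pow, mul_one] at h
    rw [h]
    refine intervalIntegral.integral_nonneg zero_le_one fun s _ => ?_
    rw [eval_pow]
    positivity
  · intro r hr hrt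
    have h1 : l.eval r = 0 := Lagrange.eval_basis_of_ne (v := id) hrt.symm hr
    simp [h1]
  · exact fun h => absurd ht h

/-! ### Gauss sums of s^(-1/2). -/

open Polynomial in
/-- The Gauss rule underestimates the integral of `1 / (s + a)`. -/
theorem gauss_inv_add_le {N : ℕ} (hN : 1 ≤ N) {a : ℝ} (ha : 0 < a) :
    ∑ t ∈ gaussNodes N, gaussWeight N t * (t + a)⁻¹ ≤ ∫ s in (0 : ℝ)..1, (s + a)⁻¹ := by
  set P := legendre N with hP
  have hPa : P.eval (-a) ≠ 0 := by
    intro h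
    have := ((gaussNodes_spec N).1 _ (mem_gaussNodes.mpr h)).1
    linarith
  -- `r` vanishes at -a, and q = r/(s+a) interpolates 1/(s+a) at the nodes. It lies below 1/(s+a)
  -- because a square is subtracted, and its degree is below 2N, so the rule integrates it exactly.
  set r : ℝ[X] := 1 - C ((P.eval (-a) ^ 2)⁻¹) * P ^ 2 with hr
  have hroot : r.eval (-a) = 0 := by simp [hr, hPa]
  obtain ⟨q, hq⟩ := dvd_iff_isRoot.mpr hroot
  have hre : ∀ s, r.eval s = 1 - (P.eval (-a) ^ 2)⁻¹ * P.eval s ^ 2 := fun s => by simp [hr]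
  have hqe : ∀ s, r.eval s = (s + a) * q.eval s := fun s => by rw [hq]; simp
  have hrd : r.natDegree ≤ 2 * N := by
    refine (natDegree_sub_le _ _).trans ?_
    rw [natDegree_one, natDegree_C_mul (inv_ne_zero (pow_ne_zero 2 hPa)), natDegree_pow, hP,
      natDegree_legendre]
    omega
  have hqd : q.natDegree < 2 * N := by
    by_cases hq0 : q = 0
    · rw [hq0, natDegree_zero]; omega
    · rw [hq, natDegree_mul (X_sub_C_ne_zero _) hq0, natDegree_X_sub_C] at hrd
      omega
  have h1 : ∀ t ∈ gaussNodes N, (t + a)⁻¹ = q.eval t := by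
    intro t ht
    have h := hqe t
    have hta : 0 < t + a := add_pos ((gaussNodes_spec N).1 t ht).1 ha
    rw [hre, hP, mem_gaussNodes.mp ht] at h
    field_simp
    linarith
  rw [Finset.sum_congr rfl fun t ht => by rw [h1 t ht], gauss_exact q hqd]
  refine intervalIntegral.integral_mono_on zero_le_one (q.continuous.intervalIntegrable _ _) ?_ ?_
  · refine ContinuousOn.intervalIntegrable fun s hs => ?_
    rw [uIcc_of_le zero_le_one] at hs
    have : s + a ≠ 0 := by linarith [hs.1]
    exact ((continuousAt_id.add continuousAt_const).inv₀ this).continuousWithinAt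
  · intro s hs
    have hsa : 0 < s + a := by linarith [hs.1]
    rw [← one_div, le_div_iff₀ hsa, mul_comm, ← hqe, hre]
    have : 0 ≤ (P.eval (-a) ^ 2)⁻¹ * P.eval s ^ 2 := by positivity
    linarith

theorem inv_add_sq_eq {a : ℝ} (ha : 0 < a) (s : ℝ) :
    (a + s ^ 2)⁻¹ = a⁻¹ * (1 + (s / √a) ^ 2)⁻¹ := by
  rw [div_pow, Real.sq_sqrt ha.le, ← mul_inv]
  congr 1
  field_simp

theorem integrable_inv_add_sq {a : ℝ} (ha : 0 < a) :
    Integrable fun s : ℝ => (a + s ^ 2)⁻¹ := by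
  simp_rw [inv_add_sq_eq ha]
  exact (integrable_inv_one_add_sq.comp_div (Real.sqrt_pos.mpr ha).ne').const_mul _

theorem integral_inv_add_sq {a : ℝ} (ha : 0 < a) :
    ∫ s : ℝ, (a + s ^ 2)⁻¹ = Real.pi * (√a)⁻¹ := by
  simp_rw [inv_add_sq_eq ha]
  rw [integral_const_mul, Measure.integral_comp_div (fun s => (1 + s ^ 2)⁻¹),
    integral_univ_inv_one_add_sq, abs_of_nonneg (Real.sqrt_nonneg a), smul_eq_mul]
  have h : √a ≠ 0 := (Real.sqrt_pos.mpr ha).ne'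
  field_simp
  rw [Real.sq_sqrt ha.le]

theorem intervalIntegrable_inv_sqrt : IntervalIntegrable (fun s : ℝ => (√s)⁻¹) volume 0 1 := by
  refine (intervalIntegral.intervalIntegrable_rpow' (r := -1 / 2) (by norm_num)).congr ?_
  intro s hs
  rw [uIoc_of_le zero_le_one] at hs
  simp only
  rw [neg_div, Real.rpow_neg hs.1.le, Real.sqrt_eq_rpow]

theorem integral_inv_sqrt : ∫ s in (0 : ℝ)..1, (√s)⁻¹ = 2 := by
  have : ∫ s in (0 : ℝ)..1, (√s)⁻¹ = ∫ s in (0 : ℝ)..1, s ^ (-1 / 2 : ℝ) := by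
    refine intervalIntegral.integral_congr fun s hs => ?_
    rw [uIcc_of_le zero_le_one] at hs
    rw [neg_div, Real.rpow_neg hs.1, Real.sqrt_eq_rpow]
  rw [this, integral_rpow (Or.inl (by norm_num))]
  norm_num

/-- The Gauss rule applied to `s ↦ s ^ (-1/2)` is bounded independently of the number of nodes. -/
theorem gauss_inv_sqrt_le {N : ℕ} (hN : 1 ≤ N) :
    ∑ t ∈ gaussNodes N, gaussWeight N t * (√t)⁻¹ ≤ 2 := by
  have hpos : ∀ t ∈ gaussNodes N, 0 < t := fun t ht => ((gaussNodes_spec N).1 t ht).1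
  have hI : ∀ t ∈ gaussNodes N, Integrable fun s : ℝ => gaussWeight N t * (t + s ^ 2)⁻¹ :=
    fun t ht => (integrable_inv_add_sq (hpos t ht)).const_mul _
  -- π/√t is the integral of 1/(t + s²) over the line, which reduces the claim to the functions 1/(u
  -- + a) with a = s².
  have h1 : Real.pi * ∑ t ∈ gaussNodes N, gaussWeight N t * (√t)⁻¹ =
      ∫ s : ℝ, ∑ t ∈ gaussNodes N, gaussWeight N t * (t + s ^ 2)⁻¹ := by
    rw [integral_finsetSum _ hI, Finset.mul_sum]
    refine Finset.sum_congr rfl fun t ht => ?_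
    rw [integral_const_mul, integral_inv_add_sq (hpos t ht)]
    ring
  have h2 : ENNReal.ofReal (Real.pi * ∑ t ∈ gaussNodes N, gaussWeight N t * (√t)⁻¹) ≤
      ENNReal.ofReal (Real.pi * 2) := by
    rw [h1, ofReal_integral_eq_lintegral_ofReal (integrable_finsetSum _ hI)
      (ae_of_all _ fun s => Finset.sum_nonneg fun t ht => mul_nonneg (gaussWeight_nonneg ht)
        (inv_nonneg.mpr (by have := hpos t ht; positivity)))]
    -- Lower integrals of nonnegative functions permit the exchange of s and u without a prior
    -- integrability proof. The point s = 0, where a = s² is not positive, is null.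
    calc ∫⁻ s : ℝ, ENNReal.ofReal (∑ t ∈ gaussNodes N, gaussWeight N t * (t + s ^ 2)⁻¹)
        ≤ ∫⁻ s : ℝ, ∫⁻ u in Ioc (0 : ℝ) 1, ENNReal.ofReal ((u + s ^ 2)⁻¹) := by
          refine lintegral_mono_ae ?_
          filter_upwards [Measure.ae_ne volume (0 : ℝ)] with s hs
          have hs2 : 0 < s ^ 2 := by positivity
          rw [← ofReal_integral_eq_lintegral_ofReal, ← intervalIntegral.integral_of_le zero_le_one]
          · exact ENNReal.ofReal_le_ofReal (gauss_inv_add_le hN hs2)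
          · rw [← IntegrableOn, ← intervalIntegrable_iff_integrableOn_Ioc_of_le zero_le_one]
            refine ContinuousOn.intervalIntegrable fun u hu => ?_
            rw [uIcc_of_le zero_le_one] at hu
            have : u + s ^ 2 ≠ 0 := by linarith [hu.1]
            exact ((continuousAt_id.add continuousAt_const).inv₀ this).continuousWithinAt
          · filter_upwards [ae_restrict_mem measurableSet_Ioc] with u hu
            have := hu.1
            exact inv_nonneg.mpr (by positivity)
      _ = ∫⁻ u in Ioc (0 : ℝ) 1, ∫⁻ s : ℝ, ENNReal.ofReal ((u + s ^ 2)⁻¹) := by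
          refine lintegral_lintegral_swap (Measurable.aemeasurable ?_)
          exact ((measurable_snd.add (measurable_fst.pow_const 2)).inv).ennreal_ofReal
      _ = ∫⁻ u in Ioc (0 : ℝ) 1, ENNReal.ofReal (Real.pi * (√u)⁻¹) := by
          refine setLIntegral_congr_fun measurableSet_Ioc fun u hu => ?_
          rw [← ofReal_integral_eq_lintegral_ofReal (integrable_inv_add_sq hu.1)
            (ae_of_all _ fun s => inv_nonneg.mpr (by have := hu.1; positivity)),
            integral_inv_add_sq hu.1]
      _ = ENNReal.ofReal (Real.pi * 2) := by
          rw [← ofReal_integral_eq_lintegral_ofReal, ← intervalIntegral.integral_of_le zero_le_one,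
            intervalIntegral.integral_const_mul, integral_inv_sqrt]
          · exact (intervalIntegrable_iff_integrableOn_Ioc_of_le zero_le_one).mp
              (intervalIntegrable_inv_sqrt.const_mul _)
          · exact ae_of_all _ fun u => by positivity
  have h3 := (ENNReal.ofReal_le_ofReal_iff (by positivity)).mp h2
  exact le_of_mul_le_mul_left h3 Real.pi_pos

/-! ### A Jackson-type kernel. -/

/-- The coefficients of the trigonometric polynomial whose squared modulus is the kernel below. -/
noncomputable def kernelCoeff (m j : ℕ) : ℝ := j * (m - j)

/-- A nonnegative trigonometric kernel of degree less than `m` concentrated near `0`. -/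
noncomputable def trigKernel (m : ℕ) (φ : ℝ) : ℝ :=
  (∑ j ∈ Finset.range m, kernelCoeff m j * Real.cos (j * φ)) ^ 2 +
    (∑ j ∈ Finset.range m, kernelCoeff m j * Real.sin (j * φ)) ^ 2

theorem trigKernel_nonneg (m : ℕ) (φ : ℝ) : 0 ≤ trigKernel m φ := by
  unfold trigKernel; positivity

theorem continuous_trigKernel (m : ℕ) : Continuous (trigKernel m) := by
  unfold trigKernel; fun_prop

theorem trigKernel_eq (m : ℕ) (φ : ℝ) : trigKernel m φ = ∑ j ∈ Finset.range m,
    ∑ k ∈ Finset.range m,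
      kernelCoeff m j * kernelCoeff m k * Real.cos (((j - k : ℤ) : ℝ) * φ) := by
  rw [trigKernel, pow_two, pow_two, Finset.sum_mul_sum, Finset.sum_mul_sum,
    ← Finset.sum_add_distrib]
  refine Finset.sum_congr rfl fun j _ => ?_
  rw [← Finset.sum_add_distrib]
  refine Finset.sum_congr rfl fun k _ => ?_
  push_cast
  rw [sub_mul, Real.cos_sub]
  ring

theorem trigKernel_periodic (m : ℕ) : Function.Periodic (trigKernel m) (2 * Real.pi) := by
  intro φ
  rw [trigKernel_eq, trigKernel_eq]
  refine Finset.sum_congr rfl fun j _ => Finset.sum_congr rfl fun k _ => ?_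
  rw [mul_add, Real.cos_add_int_mul_two_pi]

theorem integral_cos_int_mul (n : ℤ) :
    ∫ φ in (-Real.pi)..Real.pi, Real.cos (n * φ) = if n = 0 then 2 * Real.pi else 0 := by
  split_ifs with h
  · subst h; simp; ring
  · have hn : (n : ℝ) ≠ 0 := by exact_mod_cast h
    rw [intervalIntegral.integral_comp_mul_left _ hn]
    simp [Real.sin_int_mul_pi]

theorem integral_cos_int_mul_mul_cos (n : ℤ) :
    ∫ φ in (-Real.pi)..Real.pi, Real.cos (n * φ) * Real.cos φ =
      (if n = -1 then Real.pi else 0) + (if n = 1 then Real.pi else 0) := by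
  have h : ∀ φ : ℝ, Real.cos (n * φ) * Real.cos φ =
      1 / 2 * (Real.cos (((n + 1 : ℤ) : ℝ) * φ) + Real.cos (((n - 1 : ℤ) : ℝ) * φ)) := by
    intro φ
    push_cast
    rw [add_mul, sub_mul, one_mul, Real.cos_add, Real.cos_sub]
    ring
  simp_rw [h]
  rw [intervalIntegral.integral_const_mul, intervalIntegral.integral_add
    (Continuous.intervalIntegrable (by fun_prop) _ _)
    (Continuous.intervalIntegrable (by fun_prop) _ _),
    integral_cos_int_mul, integral_cos_int_mul]
  have h1 : n + 1 = 0 ↔ n = -1 := by omega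
  have h2 : n - 1 = 0 ↔ n = 1 := by omega
  simp only [h1, h2]
  split_ifs <;> ring

theorem integral_trigKernel_mul {m : ℕ} {f : ℝ → ℝ} (hf : Continuous f) {a b : ℝ} :
    ∫ φ in a..b, trigKernel m φ * f φ = ∑ j ∈ Finset.range m, ∑ k ∈ Finset.range m,
      kernelCoeff m j * kernelCoeff m k *
        ∫ φ in a..b, Real.cos (((j - k : ℤ) : ℝ) * φ) * f φ := by
  simp_rw [trigKernel_eq, Finset.sum_mul]
  rw [intervalIntegral.integral_finsetSum
    fun j _ => Continuous.intervalIntegrable (by fun_prop) _ _]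
  refine Finset.sum_congr rfl fun j _ => ?_
  rw [intervalIntegral.integral_finsetSum
    fun j _ => Continuous.intervalIntegrable (by fun_prop) _ _]
  refine Finset.sum_congr rfl fun k _ => ?_
  simp_rw [mul_assoc]
  rw [intervalIntegral.integral_const_mul, intervalIntegral.integral_const_mul]

/-- The upper limit is kept separate from `m` to permit induction; at n = m the value is (m⁵ -
m)/30. -/
theorem sum_kernelCoeff_sq (m n : ℕ) : ∑ j ∈ Finset.range n, kernelCoeff m j * kernelCoeff m j =
    (m : ℝ) ^ 2 * ((n - 1) * n * (2 * n - 1) / 6) - 2 * m * ((n - 1) * n / 2) ^ 2 +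
      (n - 1) * n * (2 * n - 1) * (3 * (n - 1) ^ 2 + 3 * (n - 1) - 1) / 30 := by
  induction n with
  | zero => simp
  | succ n ih =>
    rw [Finset.sum_range_succ, ih, kernelCoeff]
    push_cast
    ring

/-- The subtracted bracket sums a_j (a_j - a_{j+1}), where a_j - a_{j+1} = 2j + 1 - m. At n = m it
measures the second moment of the kernel through 1 - cos. -/
theorem sum_kernelCoeff_mul_succ (m n : ℕ) :
    ∑ j ∈ Finset.range n, kernelCoeff m j * kernelCoeff m (j + 1) =
    ∑ j ∈ Finset.range n, kernelCoeff m j * kernelCoeff m j -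
      (-2 * ((n - 1) * n / 2) ^ 2 + (3 * m - 1) * ((n - 1) * n * (2 * n - 1) / 6) +
        m * (1 - m) * ((n - 1) * n / 2)) := by
  induction n with
  | zero => simp
  | succ n ih =>
    rw [Finset.sum_range_succ, Finset.sum_range_succ, ih, kernelCoeff, kernelCoeff]
    push_cast
    ring

theorem integral_trigKernel (m : ℕ) :
    ∫ φ in (-Real.pi)..Real.pi, trigKernel m φ = 2 * Real.pi * ((m : ℝ) ^ 5 - m) / 30 := by
  have h := integral_trigKernel_mul (m := m) (f := fun _ => 1) continuous_const
    (a := -Real.pi) (b := Real.pi)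
  simp only [mul_one, integral_cos_int_mul] at h
  rw [h]
  calc _ = ∑ j ∈ Finset.range m, 2 * Real.pi * (kernelCoeff m j * kernelCoeff m j) := by
        refine Finset.sum_congr rfl fun j hj => ?_
        rw [Finset.sum_eq_single j]
        · simp; ring
        · intro k _ hk
          rw [if_neg (by omega), mul_zero]
        · exact fun h => absurd hj h
    _ = _ := by
        rw [← Finset.mul_sum, sum_kernelCoeff_sq]
        ring

theorem integral_trigKernel_mul_cos (m : ℕ) :
    ∫ φ in (-Real.pi)..Real.pi, trigKernel m φ * Real.cos φ =
      2 * Real.pi * ∑ j ∈ Finset.range m, kernelCoeff m j * kernelCoeff m (j + 1) := by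
  have key : ∀ j ∈ Finset.range m, ∑ k ∈ Finset.range m, kernelCoeff m j * kernelCoeff m k *
      (if (j - k : ℤ) = -1 then Real.pi else 0) =
      Real.pi * (kernelCoeff m j * kernelCoeff m (j + 1)) := by
    intro j hj
    rw [Finset.sum_eq_single (j + 1)]
    · rw [if_pos (by push_cast; ring)]; ring
    · intro k _ hk
      rw [if_neg (by omega), mul_zero]
    -- For the last j the neighbour j + 1 = m is out of range, but its coefficient is zero.
    · intro hj'
      have : j + 1 = m := by
        rw [Finset.mem_range] at hj hj'
        omega
      rw [this, kernelCoeff.eq_def m m]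
      simp
  rw [integral_trigKernel_mul Real.continuous_cos]
  simp_rw [integral_cos_int_mul_mul_cos, mul_add, Finset.sum_add_distrib]
  rw [Finset.sum_congr rfl key]
  conv_lhs => enter [2]; rw [Finset.sum_comm]
  have key2 : ∀ j ∈ Finset.range m, ∑ k ∈ Finset.range m, kernelCoeff m k * kernelCoeff m j *
      (if (k - j : ℤ) = 1 then Real.pi else 0) =
      Real.pi * (kernelCoeff m j * kernelCoeff m (j + 1)) := by
    intro j hj
    rw [← key j hj]
    refine Finset.sum_congr rfl fun k _ => ?_
    have : (k - j : ℤ) = 1 ↔ (j - k : ℤ) = -1 := by omega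
    simp only [this]
    ring
  rw [Finset.sum_congr rfl key2, ← Finset.mul_sum]
  ring

theorem integral_trigKernel_pos {N : ℕ} (hN : 1 ≤ N) :
    0 < ∫ φ in (-Real.pi)..Real.pi, trigKernel (2 * N) φ := by
  rw [integral_trigKernel]
  have h : (1 : ℝ) < ((2 * N : ℕ) : ℝ) := by exact_mod_cast (by omega : 1 < 2 * N)
  have h5 : (((2 * N : ℕ) : ℝ)) ^ 1 < ((2 * N : ℕ) : ℝ) ^ 5 := pow_lt_pow_right₀ h (by norm_num)
  rw [pow_one] at h5
  have := Real.pi_pos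
  have := sub_pos.mpr h5
  positivity

/-- The kernel has first absolute moment `O(1/N)`. -/
theorem integral_trigKernel_mul_abs_sin_le {N : ℕ} (hN : 1 ≤ N) :
    ∫ φ in (-Real.pi)..Real.pi, trigKernel (2 * N) φ * |Real.sin (φ / 2)| ≤
      (N : ℝ)⁻¹ * ∫ φ in (-Real.pi)..Real.pi, trigKernel (2 * N) φ := by
  have hc := continuous_trigKernel (2 * N)
  have hN1 : (1 : ℝ) ≤ N := by exact_mod_cast hN
  have hN0 : (0 : ℝ) < N := by linarith
  have h1 : ∫ φ in (-Real.pi)..Real.pi, trigKernel (2 * N) φ * |Real.sin (φ / 2)| ≤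
      ∫ φ in (-Real.pi)..Real.pi, ((N / 4 + (2 * N : ℝ)⁻¹) * trigKernel (2 * N) φ -
        N / 4 * (trigKernel (2 * N) φ * Real.cos φ)) := by
    refine intervalIntegral.integral_mono_on (by linarith [Real.pi_pos])
      (Continuous.intervalIntegrable (by fun_prop) _ _)
      (Continuous.intervalIntegrable (by fun_prop) _ _) fun φ _ => ?_
    have hs : Real.sin (φ / 2) ^ 2 = 1 / 2 - Real.cos φ / 2 := by
      rw [Real.sin_sq_eq_half_sub]
      ring_nf
    -- Arithmetic–geometric mean at scale 1/N: the first absolute moment is controlled by the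
    -- second, which is explicit.
    have h2 : |Real.sin (φ / 2)| ≤ N / 2 * Real.sin (φ / 2) ^ 2 + (2 * N : ℝ)⁻¹ := by
      rw [← sq_abs]
      have : N / 2 * |Real.sin (φ / 2)| ^ 2 + (2 * N : ℝ)⁻¹ - |Real.sin (φ / 2)| =
          (2 * N : ℝ)⁻¹ * (N * |Real.sin (φ / 2)| - 1) ^ 2 := by
        field_simp
        ring
      have : 0 ≤ (2 * N : ℝ)⁻¹ * (N * |Real.sin (φ / 2)| - 1) ^ 2 := by positivity
      linarith
    calc trigKernel (2 * N) φ * |Real.sin (φ / 2)|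
        ≤ trigKernel (2 * N) φ * (N / 2 * Real.sin (φ / 2) ^ 2 + (2 * N : ℝ)⁻¹) :=
          mul_le_mul_of_nonneg_left h2 (trigKernel_nonneg _ _)
      _ = _ := by rw [hs]; ring
  refine h1.trans ?_
  rw [intervalIntegral.integral_sub (Continuous.intervalIntegrable (by fun_prop) _ _)
    (Continuous.intervalIntegrable (by fun_prop) _ _), intervalIntegral.integral_const_mul,
    intervalIntegral.integral_const_mul, integral_trigKernel_mul_cos, sum_kernelCoeff_mul_succ,
    sum_kernelCoeff_sq, integral_trigKernel]
  push_cast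
  have hpi := Real.pi_pos
  rw [← sub_nonneg]
  -- The slack in the claimed inequality, computed exactly; it is positive for N ≥ 1.
  have e : (N : ℝ)⁻¹ * (2 * Real.pi * ((2 * N : ℝ) ^ 5 - 2 * N) / 30) -
      ((N / 4 + (2 * N : ℝ)⁻¹) * (2 * Real.pi * ((2 * N : ℝ) ^ 5 - 2 * N) / 30) -
      N / 4 * (2 * Real.pi * ((2 * N : ℝ) ^ 2 * ((2 * N - 1) * (2 * N) * (2 * (2 * N) - 1) / 6) -
        2 * (2 * N) * ((2 * N - 1) * (2 * N) / 2) ^ 2 +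
        (2 * N - 1) * (2 * N) * (2 * (2 * N) - 1) *
          (3 * (2 * N - 1) ^ 2 + 3 * (2 * N - 1) - 1) / 30 -
        (-2 * ((2 * N - 1) * (2 * N) / 2) ^ 2 +
          (3 * (2 * N) - 1) * ((2 * N - 1) * (2 * N) * (2 * (2 * N) - 1) / 6) +
          2 * N * (1 - 2 * N) * ((2 * N - 1) * (2 * N) / 2))))) =
      Real.pi * (2 / 5 * N ^ 4 + N ^ 2 / 6 - 1 / 15) := by
    field_simp
    ring
  rw [e]
  have : (1 : ℝ) ≤ N ^ 4 := one_le_pow₀ hN1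
  have : (1 : ℝ) ≤ N ^ 2 := one_le_pow₀ hN1
  exact mul_nonneg hpi.le (by linarith)

/-! ### Log-Lipschitz functions: polynomial approximation and quadrature error. -/

/-- `|H u - H v| ≤ A |u - v| / max u v` on `[0,1]`: Lipschitz continuity on the scale of `log u`,
together with boundedness near `0`. -/
def LogLipschitz (A : ℝ) (H : ℝ → ℝ) : Prop :=
  ∀ u ∈ Icc (0 : ℝ) 1, ∀ v ∈ Icc (0 : ℝ) 1, |H u - H v| * max u v ≤ A * |u - v|

theorem LogLipschitz.nonneg {A : ℝ} {H : ℝ → ℝ} (hH : LogLipschitz A H) : 0 ≤ A := by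
  have := hH 0 (by simp) 1 (by simp)
  simp only [zero_sub, abs_neg, abs_one, mul_one, zero_le_one, sup_of_le_right] at this
  exact (abs_nonneg _).trans this

theorem LogLipschitz.abs_apply_le {A : ℝ} {H : ℝ → ℝ} (hH : LogLipschitz A H) {u : ℝ}
    (hu : u ∈ Icc (0 : ℝ) 1) : |H u| ≤ A + |H 1| := by
  have h := hH u hu 1 (by simp)
  rw [max_eq_right hu.2, mul_one] at h
  have h1 : |u - 1| ≤ 1 := by rw [abs_le]; constructor <;> linarith [hu.1, hu.2]
  have h2 : A * |u - 1| ≤ A := mul_le_of_le_one_right hH.nonneg h1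
  have h3 : |H u| ≤ |H u - H 1| + |H 1| := by
    have := abs_add_le (H u - H 1) (H 1)
    rwa [sub_add_cancel] at this
  linarith

/-- Since p² - r² = (p - r)(p + r) and (p + r) r ≤ 2 max(p², r²), squaring the variable replaces the
scale u by its square root r. This is what makes the final weight u^(-1/2), which is integrable. -/
theorem LogLipschitz.abs_sub_sq_le {A : ℝ} {H : ℝ → ℝ} (hH : LogLipschitz A H) {p r : ℝ}
    (hp : p ∈ Icc (0 : ℝ) 1) (hr : r ∈ Ioc (0 : ℝ) 1) :
    |H (p ^ 2) - H (r ^ 2)| ≤ 2 * A * |p - r| / r := by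
  have hr0 := hr.1
  have h := hH (p ^ 2) ⟨by positivity, pow_le_one₀ hp.1 hp.2⟩ (r ^ 2)
    ⟨by positivity, pow_le_one₀ hr.1.le hr.2⟩
  set M := max (p ^ 2) (r ^ 2) with hM
  have hM0 : 0 < M := lt_of_lt_of_le (by positivity) (le_max_right _ _)
  have h1 : |p ^ 2 - r ^ 2| = |p - r| * (p + r) := by
    rw [sq_sub_sq, abs_mul, mul_comm, abs_of_nonneg (add_nonneg hp.1 hr.1.le)]
  have h2 : (p + r) * r ≤ 2 * M := by
    have := le_max_left (p ^ 2) (r ^ 2)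
    have := le_max_right (p ^ 2) (r ^ 2)
    nlinarith [sq_nonneg (p - r)]
  have h3 : 0 ≤ A * |p - r| := mul_nonneg hH.nonneg (abs_nonneg _)
  rw [le_div_iff₀ hr0, ← mul_le_mul_iff_of_pos_right hM0]
  calc |H (p ^ 2) - H (r ^ 2)| * r * M = |H (p ^ 2) - H (r ^ 2)| * M * r := by ring
    _ ≤ A * |p ^ 2 - r ^ 2| * r := mul_le_mul_of_nonneg_right h hr0.le
    _ = A * |p - r| * ((p + r) * r) := by rw [h1]; ring
    _ ≤ A * |p - r| * (2 * M) := mul_le_mul_of_nonneg_left h2 h3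
    _ = 2 * A * |p - r| * M := by ring

theorem abs_abs_sin_sub_sub_le (a b : ℝ) : |(|Real.sin (a - b)| - |Real.sin a|)| ≤ |Real.sin b| := by
  have key : ∀ x y : ℝ, |Real.sin (x + y)| ≤ |Real.sin x| + |Real.sin y| := by
    intro x y
    rw [Real.sin_add]
    refine (abs_add_le _ _).trans ?_
    rw [abs_mul, abs_mul]
    exact add_le_add (mul_le_of_le_one_right (abs_nonneg _) (Real.abs_cos_le_one _))
      (mul_le_of_le_one_left (abs_nonneg _) (Real.abs_cos_le_one _))
  have h1 := key a (-b)
  have h2 := key (a - b) b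
  rw [Real.sin_neg, abs_neg, ← sub_eq_add_neg] at h1
  rw [sub_add_cancel] at h2
  rw [abs_le]
  constructor <;> linarith

open Polynomial in
/-- The convolution of the kernel with an even `2π`-periodic function is a polynomial in `cos`. -/
theorem exists_poly_convolution (m : ℕ) (hm : 0 < m) (F : ℝ → ℝ)
    (hF : IntervalIntegrable F volume (-Real.pi) Real.pi) (heven : ∀ x, F (-x) = F x)
    (hper : Function.Periodic F (2 * Real.pi)) :
    ∃ q : ℝ[X], q.natDegree < m ∧ ∀ θ : ℝ,
      ∫ φ in (-Real.pi)..Real.pi, trigKernel m φ * F (θ - φ) = q.eval (Real.cos θ) := by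
  refine ⟨∑ j ∈ Finset.range m, ∑ k ∈ Finset.range m, C (kernelCoeff m j * kernelCoeff m k *
    ∫ φ in (-Real.pi)..Real.pi, Real.cos (((j - k : ℤ) : ℝ) * φ) * F φ) *
      Chebyshev.T ℝ (j - k : ℤ), ?_, ?_⟩
  · refine Nat.lt_of_le_pred hm ?_
    refine natDegree_sum_le_of_forall_le _ _ fun j hj => ?_
    refine natDegree_sum_le_of_forall_le _ _ fun k hk => ?_
    refine (natDegree_C_mul_le _ _).trans ?_
    rw [Chebyshev.natDegree_T]
    rw [Finset.mem_range] at hj hk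
    simp only [Nat.pred_eq_sub_one]
    omega
  · intro θ
    -- Evenness of F removes the sine part, so each frequency contributes a multiple of cos(nθ), a
    -- Chebyshev polynomial in cos θ.
    have hsin : ∀ n : ℝ, ∫ φ in (-Real.pi)..Real.pi, Real.sin (n * φ) * F φ = 0 := by
      intro n
      have h := intervalIntegral.integral_comp_neg (a := -Real.pi) (b := Real.pi)
        (fun φ => Real.sin (n * φ) * F φ)
      simp only [heven, mul_neg, Real.sin_neg, neg_mul, intervalIntegral.integral_neg,
        neg_neg] at h
      linarith
    have hi1 : ∀ n : ℝ, IntervalIntegrable (fun φ => Real.cos (n * φ) * F φ) volume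
        (-Real.pi) Real.pi := fun n =>
      hF.continuousOn_mul (Continuous.continuousOn (by fun_prop))
    have hi2 : ∀ n : ℝ, IntervalIntegrable (fun φ => Real.sin (n * φ) * F φ) volume
        (-Real.pi) Real.pi := fun n =>
      hF.continuousOn_mul (Continuous.continuousOn (by fun_prop))
    have hcos : ∀ n : ℝ, ∫ φ in (-Real.pi)..Real.pi, Real.cos (n * (θ - φ)) * F φ =
        Real.cos (n * θ) * ∫ φ in (-Real.pi)..Real.pi, Real.cos (n * φ) * F φ := by
      intro n
      have : ∀ φ, Real.cos (n * (θ - φ)) * F φ = Real.cos (n * θ) * (Real.cos (n * φ) * F φ) +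
          Real.sin (n * θ) * (Real.sin (n * φ) * F φ) := by
        intro φ
        rw [mul_sub, Real.cos_sub]
        ring
      simp_rw [this]
      rw [intervalIntegral.integral_add ((hi1 n).const_mul _) ((hi2 n).const_mul _),
        intervalIntegral.integral_const_mul, intervalIntegral.integral_const_mul, hsin]
      ring
    have hi3 : ∀ n : ℝ, IntervalIntegrable (fun φ => Real.cos (n * (θ - φ)) * F φ) volume
        (-Real.pi) Real.pi := fun n =>
      hF.continuousOn_mul (Continuous.continuousOn (by fun_prop))
    -- By periodicity the shift θ can be moved from F to the kernel.
    have h1 : ∫ φ in (-Real.pi)..Real.pi, trigKernel m φ * F (θ - φ) =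
        ∫ φ in (-Real.pi)..Real.pi, trigKernel m (θ - φ) * F φ := by
      have h := intervalIntegral.integral_comp_sub_left (a := -Real.pi) (b := Real.pi)
        (fun φ => trigKernel m (θ - φ) * F φ) θ
      simp only [sub_sub_cancel] at h
      rw [h]
      have hp : Function.Periodic (fun φ => trigKernel m (θ - φ) * F φ) (2 * Real.pi) := by
        intro φ
        simp only
        rw [hper φ, ← sub_sub, (trigKernel_periodic m).sub_eq]
      have := hp.intervalIntegral_add_eq (θ - Real.pi) (-Real.pi)
      rw [show θ - Real.pi + 2 * Real.pi = θ - -Real.pi by ring,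
        show -Real.pi + 2 * Real.pi = Real.pi by ring] at this
      exact this
    rw [h1]
    simp_rw [trigKernel_eq, Finset.sum_mul, mul_assoc]
    rw [intervalIntegral.integral_finsetSum, eval_finsetSum]
    · refine Finset.sum_congr rfl fun j _ => ?_
      rw [intervalIntegral.integral_finsetSum, eval_finsetSum]
      · refine Finset.sum_congr rfl fun k _ => ?_
        rw [intervalIntegral.integral_const_mul, intervalIntegral.integral_const_mul, hcos,
          eval_mul, eval_C, Chebyshev.T_real_cos]
        ring
      · exact fun k _ => ((hi3 _).const_mul _).const_mul _
    · intro j _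
      rw [← Finset.sum_fn]
      exact IntervalIntegrable.sum _ fun k _ => ((hi3 _).const_mul _).const_mul _

open Polynomial in
/-- Jackson type approximation of a log-Lipschitz function by polynomials. -/
theorem LogLipschitz.exists_poly {A : ℝ} {H : ℝ → ℝ} (hH : LogLipschitz A H) (hm : Measurable H)
    {N : ℕ} (hN : 1 ≤ N) : ∃ q : ℝ[X], q.natDegree < 2 * N ∧
      ∀ u ∈ Ioc (0 : ℝ) 1, |H u - q.eval u| ≤ 2 * A * (N : ℝ)⁻¹ * (√u)⁻¹ := by
  set F : ℝ → ℝ := fun θ => H (|Real.sin (θ / 2)| ^ 2) with hFdef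
  have hsin01 : ∀ θ : ℝ, |Real.sin θ| ∈ Icc (0 : ℝ) 1 :=
    fun θ => ⟨abs_nonneg _, Real.abs_sin_le_one _⟩
  have hFm : Measurable F := hm.comp (by fun_prop)
  have hFb : ∀ θ, |F θ| ≤ A + |H 1| := fun θ =>
    hH.abs_apply_le ⟨by positivity, pow_le_one₀ (hsin01 _).1 (hsin01 _).2⟩
  have hFi : ∀ a b, IntervalIntegrable F volume a b := fun a b =>
    (intervalIntegrable_const (c := A + |H 1|)).mono_fun hFm.aestronglyMeasurable
      (ae_of_all _ fun θ => by
        simp only [Real.norm_eq_abs]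
        exact (hFb θ).trans (le_abs_self _))
  obtain ⟨q₀, hq₀, hq⟩ := exists_poly_convolution (2 * N) (by omega) F (hFi _ _)
    (fun x => by simp only [hFdef]; rw [neg_div, Real.sin_neg, abs_neg])
    (fun x => by
      simp only [hFdef]
      rw [add_div, mul_div_cancel_left₀ _ (two_ne_zero' ℝ), Real.sin_add_pi, abs_neg])
  set I := ∫ φ in (-Real.pi)..Real.pi, trigKernel (2 * N) φ with hI
  have hIpos : 0 < I := integral_trigKernel_pos hN
  -- The convolution is normalized by the mass of the kernel and read in u through cos θ = 1 - 2u.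
  refine ⟨C I⁻¹ * q₀.comp (1 - 2 * X), ?_, fun u hu => ?_⟩
  · refine lt_of_le_of_lt (natDegree_C_mul_le _ _) ?_
    refine lt_of_le_of_lt natDegree_comp_le ?_
    have : (1 - 2 * X : ℝ[X]).natDegree ≤ 1 := by compute_degree
    exact lt_of_le_of_lt (mul_le_of_le_one_right (Nat.zero_le _) this) hq₀
  · set θ := 2 * Real.arcsin (√u) with hθ
    have hsu : √u ∈ Ioc (0 : ℝ) 1 := ⟨Real.sqrt_pos.mpr hu.1, Real.sqrt_le_one.mpr hu.2⟩
    have hθ2 : θ / 2 = Real.arcsin (√u) := by rw [hθ]; ring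
    have hsθ : Real.sin (θ / 2) = √u := by
      rw [hθ2, Real.sin_arcsin (by linarith [hsu.1]) hsu.2]
    have hcos : Real.cos θ = 1 - 2 * u := by
      have := Real.sin_sq_eq_half_sub (θ / 2)
      rw [hsθ, Real.sq_sqrt hu.1.le, mul_div_cancel₀ _ (two_ne_zero' ℝ)] at this
      linarith
    have hFθ : H u = F θ := by
      simp only [hFdef]
      rw [hsθ, abs_of_pos hsu.1, Real.sq_sqrt hu.1.le]
    have heval : (C I⁻¹ * q₀.comp (1 - 2 * X)).eval u =
        I⁻¹ * ∫ φ in (-Real.pi)..Real.pi, trigKernel (2 * N) φ * F (θ - φ) := by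
      rw [hq, hcos]
      simp
    have hFi' : IntervalIntegrable (fun φ => trigKernel (2 * N) φ * F (θ - φ)) volume
        (-Real.pi) Real.pi := by
      refine IntervalIntegrable.continuousOn_mul ?_ (continuous_trigKernel _).continuousOn
      simpa using ((hFi (θ - -Real.pi) (θ - Real.pi)).comp_sub_left θ)
    have hdiff : H u - (C I⁻¹ * q₀.comp (1 - 2 * X)).eval u =
        I⁻¹ * ∫ φ in (-Real.pi)..Real.pi, trigKernel (2 * N) φ * (F θ - F (θ - φ)) := by
      simp_rw [mul_sub]
      rw [heval, intervalIntegral.integral_sub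
        (((continuous_trigKernel _).intervalIntegrable _ _).mul_const _) hFi',
        intervalIntegral.integral_mul_const, ← hI, mul_sub, ← mul_assoc, inv_mul_cancel₀ hIpos.ne',
        one_mul, hFθ]
    -- The centre r = sin(θ/2) = √u is fixed while p = |sin((θ-φ)/2)| may be 0, which is why the
    -- log-Lipschitz bound includes the endpoint.
    have hpt : ∀ φ, |F θ - F (θ - φ)| ≤ 2 * A / √u * |Real.sin (φ / 2)| := by
      intro φ
      rw [abs_sub_comm]
      have h := hH.abs_sub_sq_le (hsin01 ((θ - φ) / 2)) (r := |Real.sin (θ / 2)|)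
        (by rw [hsθ, abs_of_pos hsu.1]; exact hsu)
      refine h.trans ?_
      have h2 := abs_abs_sin_sub_sub_le (θ / 2) (φ / 2)
      rw [← sub_div] at h2
      rw [hsθ, abs_of_pos hsu.1] at h2 ⊢
      rw [div_mul_eq_mul_div]
      have := hH.nonneg
      have := hsu.1
      gcongr
    rw [hdiff, abs_mul, abs_of_pos (inv_pos.mpr hIpos)]
    have hint : |∫ φ in (-Real.pi)..Real.pi, trigKernel (2 * N) φ * (F θ - F (θ - φ))| ≤
        ∫ φ in (-Real.pi)..Real.pi, 2 * A / √u * (trigKernel (2 * N) φ * |Real.sin (φ / 2)|) := by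
      refine intervalIntegral.norm_integral_le_of_norm_le (f := fun φ =>
        trigKernel (2 * N) φ * (F θ - F (θ - φ))) (by linarith [Real.pi_pos])
        (ae_of_all _ fun φ _ => ?_) ?_
      · rw [Real.norm_eq_abs, abs_mul, abs_of_nonneg (trigKernel_nonneg _ _)]
        calc _ ≤ trigKernel (2 * N) φ * (2 * A / √u * |Real.sin (φ / 2)|) :=
              mul_le_mul_of_nonneg_left (hpt φ) (trigKernel_nonneg _ _)
          _ = _ := by ring
      · have := continuous_trigKernel (2 * N)
        exact Continuous.intervalIntegrable (by fun_prop) _ _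
    rw [intervalIntegral.integral_const_mul] at hint
    have hc : 0 ≤ 2 * A / √u := by have := hH.nonneg; positivity
    calc I⁻¹ * _ ≤ I⁻¹ * (2 * A / √u * ((N : ℝ)⁻¹ * I)) :=
          mul_le_mul_of_nonneg_left (hint.trans (mul_le_mul_of_nonneg_left
            (integral_trigKernel_mul_abs_sin_le hN) hc)) (inv_nonneg.mpr hIpos.le)
      _ = 2 * A * (N : ℝ)⁻¹ * (√u)⁻¹ := by
          field_simp

theorem LogLipschitz.continuousOn {A : ℝ} {H : ℝ → ℝ} (hH : LogLipschitz A H) :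
    ContinuousOn H (Ioc 0 1) := by
  intro v hv
  have hlim : Tendsto (fun u => A * |u - v| / v) (𝓝[Ioc 0 1] v) (𝓝 0) := by
    have : ContinuousAt (fun u : ℝ => A * |u - v| / v) v := by fun_prop
    simpa using this.tendsto.mono_left nhdsWithin_le_nhds
  rw [ContinuousWithinAt, tendsto_iff_dist_tendsto_zero]
  refine squeeze_zero' (Eventually.of_forall fun _ => dist_nonneg) ?_ hlim
  filter_upwards [self_mem_nhdsWithin] with u hu
  rw [Real.dist_eq, le_div_iff₀ hv.1]
  exact (mul_le_mul_of_nonneg_left (le_max_right u v) (abs_nonneg _)).trans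
    (hH u (Ioc_subset_Icc_self hu) v (Ioc_subset_Icc_self hv))

/-- `H` is arbitrary off [0,1]; measurability on the whole line is needed for the composition with
sin². -/
theorem LogLipschitz.exists_measurable {A : ℝ} {H : ℝ → ℝ} (hH : LogLipschitz A H) :
    ∃ H' : ℝ → ℝ, Measurable H' ∧ LogLipschitz A H' ∧ EqOn H H' (Icc 0 1) := by
  classical
  have heq : EqOn H ((Ioc (0 : ℝ) 1).piecewise H fun _ => H 0) (Icc 0 1) := by
    intro u hu
    rcases hu.1.eq_or_lt with rfl | h0
    · simp
    · rw [piecewise_eq_of_mem _ _ _ (mem_Ioc.mpr ⟨h0, hu.2⟩)]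
  refine ⟨_, hH.continuousOn.measurable_piecewise continuousOn_const measurableSet_Ioc, ?_, heq⟩
  intro u hu v hv
  rw [← heq hu, ← heq hv]
  exact hH u hu v hv

theorem LogLipschitz.intervalIntegrable {A : ℝ} {H : ℝ → ℝ} (hH : LogLipschitz A H) :
    IntervalIntegrable H volume 0 1 := by
  refine (intervalIntegrable_const (c := A + |H 1|)).mono_fun ?_ ?_
  · rw [uIoc_of_le zero_le_one]
    exact hH.continuousOn.aestronglyMeasurable measurableSet_Ioc
  · rw [uIoc_of_le zero_le_one]
    filter_upwards [ae_restrict_mem measurableSet_Ioc] with u hu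
    rw [Real.norm_eq_abs, Real.norm_eq_abs]
    exact (hH.abs_apply_le (Ioc_subset_Icc_self hu)).trans (le_abs_self _)

/-- Error of the Gauss rule for log-Lipschitz functions. -/
theorem LogLipschitz.gauss_error {A : ℝ} {H : ℝ → ℝ} (hH : LogLipschitz A H)
    {N : ℕ} (hN : 1 ≤ N) :
    |(∫ s in (0 : ℝ)..1, H s) - ∑ t ∈ gaussNodes N, gaussWeight N t * H t| ≤
      8 * A * (N : ℝ)⁻¹ := by
  obtain ⟨H', hm, hH', heq⟩ := hH.exists_measurable
  obtain ⟨q, hqd, hq'⟩ := hH'.exists_poly hm hN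
  have hq : ∀ u ∈ Ioc (0 : ℝ) 1, |H u - q.eval u| ≤ 2 * A * (N : ℝ)⁻¹ * (√u)⁻¹ :=
    fun u hu => by rw [heq (Ioc_subset_Icc_self hu)]; exact hq' u hu
  have hHi := hH.intervalIntegrable
  have h1 : |∫ s in (0 : ℝ)..1, (H s - q.eval s)| ≤
      ∫ s in (0 : ℝ)..1, 2 * A * (N : ℝ)⁻¹ * (√s)⁻¹ :=
    intervalIntegral.norm_integral_le_of_norm_le (f := fun s => H s - q.eval s) zero_le_one
      (ae_of_all _ fun s hs => hq s hs) (intervalIntegrable_inv_sqrt.const_mul _)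
  rw [intervalIntegral.integral_sub hHi (q.continuous.intervalIntegrable _ _),
    intervalIntegral.integral_const_mul, integral_inv_sqrt, ← gauss_exact q hqd] at h1
  have hc : 0 ≤ 2 * A * (N : ℝ)⁻¹ := by have := hH.nonneg; positivity
  have h2 : |∑ t ∈ gaussNodes N, gaussWeight N t * q.eval t -
      ∑ t ∈ gaussNodes N, gaussWeight N t * H t| ≤ 2 * A * (N : ℝ)⁻¹ * 2 := by
    rw [← Finset.sum_sub_distrib]
    refine (Finset.abs_sum_le_sum_abs _ _).trans ?_
    refine le_trans ?_ (mul_le_mul_of_nonneg_left (gauss_inv_sqrt_le hN) hc)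
    rw [Finset.mul_sum]
    refine Finset.sum_le_sum fun t ht => ?_
    have hw := gaussWeight_nonneg ht
    rw [← mul_sub, abs_mul, abs_of_nonneg hw, abs_sub_comm]
    calc _ ≤ gaussWeight N t * (2 * A * (N : ℝ)⁻¹ * (√t)⁻¹) :=
          mul_le_mul_of_nonneg_left
            (hq t (Ioo_subset_Ioc_self ((gaussNodes_spec N).1 t ht))) hw
      _ = _ := by ring
  rw [abs_le] at h1 h2 ⊢
  constructor <;> linarith [h1.1, h1.2, h2.1, h2.2]

/-! ### Ray integrals along an optical path. -/

/-- Data for which `∫ e^{-λ T} σ` over `[a,b]` behaves as for the optical path `T`. -/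
structure OpticalPath (m a b : ℝ) (T σ : ℝ → ℝ) : Prop where
  le : a ≤ b
  pos : 0 < m
  cont : ContinuousOn T (Icc a b)
  nonneg : ∀ y ∈ Icc a b, 0 ≤ T y
  int : IntervalIntegrable σ volume a b
  lower : ∀ y ∈ Icc a b, m ≤ σ y
  mass : ∃ L : ℝ, 0 ≤ L ∧ ∀ l : ℝ, 0 < l →
    ∫ y in a..b, l * Real.exp (-(l * T y)) * σ y = 1 - Real.exp (-(l * L))

/-- The solution operator as a function of the direction cosine. -/
noncomputable def rayOp (T : ℝ → ℝ) (a b : ℝ) (g : ℝ → ℝ) (μ : ℝ) : ℝ :=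
  μ⁻¹ * ∫ y in a..b, Real.exp (-(μ⁻¹ * T y)) * g y

namespace OpticalPath

variable {m a b M : ℝ} {T σ g : ℝ → ℝ}

theorem continuousOn_exp (h : OpticalPath m a b T σ) (l : ℝ) :
    ContinuousOn (fun y => Real.exp (-(l * T y))) (uIcc a b) := by
  rw [uIcc_of_le h.le]
  exact Real.continuous_exp.comp_continuousOn (continuousOn_const.mul h.cont).neg

theorem intervalIntegrable_exp_mul (h : OpticalPath m a b T σ) (l : ℝ) {f : ℝ → ℝ}
    (hf : IntervalIntegrable f volume a b) :
    IntervalIntegrable (fun y => Real.exp (-(l * T y)) * f y) volume a b :=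
  hf.continuousOn_mul (h.continuousOn_exp l)

/-- As σ/m ≥ 1, inserting this factor turns dy into the measure σ dy, against which exponentials of
the path integrate in closed form. -/
theorem abs_integral_le (h : OpticalPath m a b T σ) (hM : 0 ≤ M)
    (hgM : ∀ᵐ y, y ∈ Ioc a b → |g y| ≤ M) {k w : ℝ → ℝ}
    (hkw : ∀ y ∈ Icc a b, |k y| ≤ w y)
    (hw : IntervalIntegrable (fun y => w y * σ y) volume a b) :
    |∫ y in a..b, k y * g y| ≤ M / m * ∫ y in a..b, w y * σ y := by
  rw [← intervalIntegral.integral_const_mul]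
  refine intervalIntegral.norm_integral_le_of_norm_le (f := fun y => k y * g y) h.le ?_
    (hw.const_mul _)
  filter_upwards [hgM] with y hy hyI
  have hyI' := Ioc_subset_Icc_self hyI
  have hw0 : 0 ≤ w y := (abs_nonneg _).trans (hkw y hyI')
  have hm := h.pos
  have hσ : 1 ≤ σ y / m := (one_le_div hm).mpr (h.lower y hyI')
  rw [Real.norm_eq_abs, abs_mul]
  calc |k y| * |g y| ≤ w y * M := mul_le_mul (hkw y hyI') (hy hyI) (abs_nonneg _) hw0
    _ ≤ w y * M * (σ y / m) := le_mul_of_one_le_right (mul_nonneg hw0 hM) hσ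
    _ = M / m * (w y * σ y) := by ring

theorem abs_rayOp_le (h : OpticalPath m a b T σ) (hM : 0 ≤ M)
    (hgM : ∀ᵐ y, y ∈ Ioc a b → |g y| ≤ M) {μ : ℝ} (hμ : 0 < μ) :
    |rayOp T a b g μ| ≤ M / m := by
  obtain ⟨L, hL, hmass⟩ := h.mass
  have hl := inv_pos.mpr hμ
  rw [rayOp, ← intervalIntegral.integral_const_mul]
  simp_rw [← mul_assoc]
  have h1 := h.abs_integral_le hM hgM (k := fun y => μ⁻¹ * Real.exp (-(μ⁻¹ * T y)))
    (w := fun y => μ⁻¹ * Real.exp (-(μ⁻¹ * T y))) (fun y _ => by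
      rw [abs_of_nonneg]; positivity) (by
      simp_rw [mul_assoc]
      exact (h.intervalIntegrable_exp_mul _ h.int).const_mul _)
  rw [hmass _ hl] at h1
  refine h1.trans (mul_le_of_le_one_right (div_nonneg hM h.pos.le) ?_)
  have := Real.exp_pos (-(μ⁻¹ * L))
  linarith

/-- The difference of kernels is split as (μ⁻¹ - ν⁻¹) e^{-T/μ} minus ν⁻¹ (e^{-T/ν} - e^{-T/μ}). Both
pieces are nonnegative, so their sum dominates the difference and integrates exactly against σ. -/
theorem abs_rayOp_sub_le (h : OpticalPath m a b T σ) (hM : 0 ≤ M)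
    (hg : IntervalIntegrable g volume a b)
    (hgM : ∀ᵐ y, y ∈ Ioc a b → |g y| ≤ M) {μ ν : ℝ} (hμ : 0 < μ) (hμν : μ ≤ ν) :
    |rayOp T a b g μ - rayOp T a b g ν| * ν ≤ 2 * (M / m) * (ν - μ) := by
  obtain ⟨L, hL, hmass⟩ := h.mass
  have hν : 0 < ν := hμ.trans_le hμν
  have hl : ν⁻¹ ≤ μ⁻¹ := inv_anti₀ hμ hμν
  have hν' := inv_pos.mpr hν
  have hμ' := inv_pos.mpr hμ
  set ρ := μ / ν with hρ
  have hρμ : ρ * μ⁻¹ = ν⁻¹ := by rw [hρ]; field_simp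
  have hρ1 : ρ ≤ 1 := (div_le_one hν).mpr hμν
  have heq : rayOp T a b g μ - rayOp T a b g ν = ∫ y in a..b,
      (μ⁻¹ * Real.exp (-(μ⁻¹ * T y)) - ν⁻¹ * Real.exp (-(ν⁻¹ * T y))) * g y := by
    rw [rayOp, rayOp, ← intervalIntegral.integral_const_mul, ← intervalIntegral.integral_const_mul,
      ← intervalIntegral.integral_sub ((h.intervalIntegrable_exp_mul _ hg).const_mul _)
        ((h.intervalIntegrable_exp_mul _ hg).const_mul _)]
    congr 1
    ext y
    ring
  have hi : ∀ l : ℝ, IntervalIntegrable (fun y => l * Real.exp (-(l * T y)) * σ y) volume a b := by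
    intro l
    simp_rw [mul_assoc]
    exact (h.intervalIntegrable_exp_mul _ h.int).const_mul _
  have hexp : ∀ t : ℝ, 0 ≤ t → Real.exp (-(μ⁻¹ * t)) ≤ Real.exp (-(ν⁻¹ * t)) := fun t ht =>
    Real.exp_le_exp.mpr (neg_le_neg (mul_le_mul_of_nonneg_right hl ht))
  have hwσ : ∀ y, ((1 - 2 * ρ) * (μ⁻¹ * Real.exp (-(μ⁻¹ * T y))) +
      ν⁻¹ * Real.exp (-(ν⁻¹ * T y))) * σ y =
      (1 - 2 * ρ) * (μ⁻¹ * Real.exp (-(μ⁻¹ * T y)) * σ y) +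
        ν⁻¹ * Real.exp (-(ν⁻¹ * T y)) * σ y := fun y => by ring
  have h1 := h.abs_integral_le hM hgM
    (k := fun y => μ⁻¹ * Real.exp (-(μ⁻¹ * T y)) - ν⁻¹ * Real.exp (-(ν⁻¹ * T y)))
    -- The sum of the two pieces, rewritten by ν⁻¹ = ρ μ⁻¹.
    (w := fun y => (1 - 2 * ρ) * (μ⁻¹ * Real.exp (-(μ⁻¹ * T y))) +
      ν⁻¹ * Real.exp (-(ν⁻¹ * T y))) (fun y hy => by
      have he := hexp (T y) (h.nonneg y hy)
      have he0 := Real.exp_pos (-(μ⁻¹ * T y))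
      have h2 : ν⁻¹ * Real.exp (-(μ⁻¹ * T y)) ≤ ν⁻¹ * Real.exp (-(ν⁻¹ * T y)) :=
        mul_le_mul_of_nonneg_left he hν'.le
      have h3 : ν⁻¹ * Real.exp (-(μ⁻¹ * T y)) ≤ μ⁻¹ * Real.exp (-(μ⁻¹ * T y)) :=
        mul_le_mul_of_nonneg_right hl he0.le
      have h4 : (1 - 2 * ρ) * (μ⁻¹ * Real.exp (-(μ⁻¹ * T y))) =
          μ⁻¹ * Real.exp (-(μ⁻¹ * T y)) - 2 * (ν⁻¹ * Real.exp (-(μ⁻¹ * T y))) := by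
        rw [← hρμ]; ring
      rw [h4, abs_le]
      constructor <;> linarith)
    (by simp_rw [hwσ]; exact ((hi _).const_mul _).add (hi _))
  simp_rw [hwσ] at h1
  rw [intervalIntegral.integral_add ((hi _).const_mul _) (hi _),
    intervalIntegral.integral_const_mul, hmass _ hμ', hmass _ hν', ← heq] at h1
  have hE := hexp L hL
  have hE0 := Real.exp_pos (-(μ⁻¹ * L))
  -- The exponentials at L only help, since the one for ν is at least the one for μ.
  have h5 : (1 - 2 * ρ) * (1 - Real.exp (-(μ⁻¹ * L))) + (1 - Real.exp (-(ν⁻¹ * L))) ≤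
      2 * (1 - ρ) := by
    nlinarith [mul_nonneg (sub_nonneg.mpr hρ1) hE0.le]
  have hMm : 0 ≤ M / m := div_nonneg hM h.pos.le
  calc _ ≤ M / m * (2 * (1 - ρ)) * ν :=
        mul_le_mul_of_nonneg_right (h1.trans (mul_le_mul_of_nonneg_left h5 hMm)) hν.le
    _ = _ := by rw [hρ]; field_simp

theorem logLipschitz_rayOp (h : OpticalPath m a b T σ) (hM : 0 ≤ M)
    (hg : IntervalIntegrable g volume a b) (hgM : ∀ᵐ y, y ∈ Ioc a b → |g y| ≤ M) :
    LogLipschitz (2 * (M / m)) (rayOp T a b g) := by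
  have hMm : 0 ≤ M / m := div_nonneg hM h.pos.le
  have key : ∀ u v : ℝ, 0 ≤ u → u ≤ v →
      |rayOp T a b g u - rayOp T a b g v| * v ≤ 2 * (M / m) * (v - u) := by
    intro u v hu huv
    rcases hu.eq_or_lt with rfl | hu
    · rcases huv.eq_or_lt with rfl | hv
      · simp
      -- As 0⁻¹ = 0, the value at 0 is 0, and the claim reduces to the uniform bound.
      · have h0 : rayOp T a b g 0 = 0 := by simp [rayOp]
        rw [h0, zero_sub, abs_neg, sub_zero]
        refine mul_le_mul_of_nonneg_right ?_ hv.le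
        have := h.abs_rayOp_le hM hgM hv
        linarith
    · exact h.abs_rayOp_sub_le hM hg hgM hu huv
  intro u hu v hv
  rcases le_total u v with huv | huv
  · rw [max_eq_right huv, abs_sub_comm u v, abs_of_nonneg (sub_nonneg.mpr huv)]
    exact key u v hu.1 huv
  · rw [max_eq_left huv, abs_of_nonneg (sub_nonneg.mpr huv), abs_sub_comm]
    exact key v u hv.1 huv

end OpticalPath

/-! ### Cross-sections and their optical paths. -/

/-- The properties of a total cross-section bounded below by `m` that are used below. -/
structure CrossSection (m : ℝ) (σ : ℝ → ℝ) : Prop where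
  pos : 0 < m
  int : IntervalIntegrable σ volume 0 1
  lower : ∀ x ∈ Icc (0 : ℝ) 1, m ≤ σ x
  contAt : ∃ s : Set ℝ, s.Countable ∧ ∀ x ∈ Ioo (0 : ℝ) 1 \ s, ContinuousAt σ x

theorem HolderOnWith.intervalIntegrable_of_Ioo {C η : ℝ≥0} {f : ℝ → ℝ} {a b : ℝ}
    (h : HolderOnWith C η f (Ioo a b)) (hη : 0 < η) (hab : a < b) :
    IntervalIntegrable f volume a b := by
  rw [intervalIntegrable_iff_integrableOn_Ioo_of_le hab.le]
  have hc : (a + b) / 2 ∈ Ioo a b := ⟨by linarith, by linarith⟩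
  refine IntegrableOn.of_bound (by simp) ((h.continuousOn hη).aestronglyMeasurable
    measurableSet_Ioo) (C * (b - a) ^ (η : ℝ) + |f ((a + b) / 2)|) ?_
  filter_upwards [ae_restrict_mem measurableSet_Ioo] with x hx
  have h1 := h.dist_le hx hc
  have h2 : dist x ((a + b) / 2) ≤ b - a := by
    rw [Real.dist_eq, abs_le]
    constructor <;> linarith [hx.1, hx.2]
  have h3 : dist x ((a + b) / 2) ^ (η : ℝ) ≤ (b - a) ^ (η : ℝ) :=
    Real.rpow_le_rpow dist_nonneg h2 η.2
  have h4 := mul_le_mul_of_nonneg_left h3 C.2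
  rw [Real.dist_eq] at h1
  have h5 := abs_add_le (f x - f ((a + b) / 2)) (f ((a + b) / 2))
  rw [sub_add_cancel] at h5
  rw [Real.norm_eq_abs]
  exact h5.trans (add_le_add_left (h1.trans h4) _)

theorem PiecewiseHolder.crossSection {n : ℕ} {p : Fin (n + 1) → ℝ} {η : ℝ≥0} {σ : ℝ → ℝ}
    (hp : IsPartition p) (hη : 0 < η) (hσ : PiecewiseHolder p η σ) (hpos : 0 < sigmaMin σ) :
    CrossSection (sigmaMin σ) σ := by
  refine ⟨hpos, ?_, fun x hx => ?_, range p, countable_range p, fun x hx => ?_⟩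
  · have key : ∀ j, IntervalIntegrable σ volume (p 0) (p j) := by
      intro j
      induction j using Fin.induction with
      | zero => exact IntervalIntegrable.refl
      | succ i ih =>
        obtain ⟨C, hC⟩ := hσ.holder i
        exact ih.trans (HolderOnWith.intervalIntegrable_of_Ioo hC hη
          (hp.strictMono (Fin.castSucc_lt_succ)))
    have := key (Fin.last n)
    rwa [hp.left, hp.right] at this
  -- An image unbounded below would have `sInf` equal to 0 by convention, against positivity.
  · have hbdd : BddBelow (σ '' Icc 0 1) := by
      by_contra h
      rw [sigmaMin, Real.sInf_of_not_bddBelow h] at hpos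
      exact lt_irrefl _ hpos
    exact csInf_le hbdd (mem_image_of_mem σ hx)
  · have key : ∀ j, x < p j → ∃ i : Fin n, x ∈ Ioo (p i.castSucc) (p i.succ) := by
      intro j
      induction j using Fin.induction with
      | zero => rw [hp.left]; exact fun h => absurd hx.1.1 (not_lt.mpr h.le)
      | succ i ih =>
        intro h
        rcases lt_trichotomy x (p i.castSucc) with h1 | h1 | h1
        · exact ih h1
        · exact absurd ⟨_, h1.symm⟩ hx.2
        · exact ⟨i, h1, h⟩
    obtain ⟨i, hi⟩ := key (Fin.last n) (by rw [hp.right]; exact hx.1.2)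
    obtain ⟨C, hC⟩ := hσ.holder i
    exact (hC.continuousOn hη).continuousAt (Ioo_mem_nhds hi.1 hi.2)

namespace CrossSection

variable {m : ℝ} {σ : ℝ → ℝ}

theorem intervalIntegrable (h : CrossSection m σ) {x y : ℝ} (hx : x ∈ Icc (0 : ℝ) 1)
    (hy : y ∈ Icc (0 : ℝ) 1) : IntervalIntegrable σ volume x y := by
  refine h.int.mono_set ?_
  rw [uIcc_of_le zero_le_one]
  exact uIcc_subset_Icc hx hy

theorem tau_eq (h : CrossSection m σ) {x y : ℝ} (hx : x ∈ Icc (0 : ℝ) 1)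
    (hy : y ∈ Icc (0 : ℝ) 1) : tau σ x y = tau σ 0 y - tau σ 0 x := by
  have h0 : (0 : ℝ) ∈ Icc (0 : ℝ) 1 := by simp
  exact (intervalIntegral.integral_interval_sub_left (h.intervalIntegrable h0 hy)
    (h.intervalIntegrable h0 hx)).symm

theorem tau_nonneg (h : CrossSection m σ) {x y : ℝ} (hx : x ∈ Icc (0 : ℝ) 1)
    (hy : y ∈ Icc (0 : ℝ) 1) (hxy : x ≤ y) : 0 ≤ tau σ x y :=
  intervalIntegral.integral_nonneg hxy fun s hs =>
    h.pos.le.trans (h.lower s ⟨hx.1.trans hs.1, hs.2.trans hy.2⟩)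

theorem continuousOn_tau (h : CrossSection m σ) : ContinuousOn (tau σ 0) (Icc 0 1) := by
  have := intervalIntegral.continuousOn_primitive_interval (μ := volume) (f := σ) (a := 0) (b := 1)
    ((intervalIntegrable_iff' (by simp)).mp h.int)
  rwa [uIcc_of_le zero_le_one] at this

/-- The optical path is differentiable with derivative σ off a countable set and continuous
throughout, which suffices for the fundamental theorem. The sign of `l` is free to serve both
directions. -/
theorem integral_exp (h : CrossSection m σ) {a b : ℝ} (ha : a ∈ Icc (0 : ℝ) 1)
    (hb : b ∈ Icc (0 : ℝ) 1) (hab : a ≤ b) (l k : ℝ) :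
    ∫ y in a..b, l * Real.exp (l * (tau σ 0 y - k)) * σ y =
      Real.exp (l * (tau σ 0 b - k)) - Real.exp (l * (tau σ 0 a - k)) := by
  obtain ⟨s, hs, hcont⟩ := h.contAt
  have hsub : Icc a b ⊆ Icc 0 1 := Icc_subset_Icc ha.1 hb.2
  have hc : ContinuousOn (fun y => Real.exp (l * (tau σ 0 y - k))) (Icc a b) :=
    Real.continuous_exp.comp_continuousOn
      (continuousOn_const.mul ((h.continuousOn_tau.mono hsub).sub continuousOn_const))
  refine integral_eq_of_hasDerivAt_off_countable_of_le
    (fun y => Real.exp (l * (tau σ 0 y - k))) _ hab hs hc (fun y hy => ?_) ?_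
  · have hy1 : y ∈ Ioo (0 : ℝ) 1 := ⟨ha.1.trans_lt hy.1.1, hy.1.2.trans_le hb.2⟩
    have hm : StronglyMeasurableAtFilter σ (𝓝 y) volume :=
      ⟨Ioc 0 1, Ioc_mem_nhds hy1.1 hy1.2, h.int.1.aestronglyMeasurable⟩
    have hd : HasDerivAt (tau σ 0) (σ y) y := intervalIntegral.integral_hasDerivAt_right
      (h.intervalIntegrable (by simp) (Ioo_subset_Icc_self hy1)) hm (hcont y ⟨hy1, hy.2⟩)
    have e : l * Real.exp (l * (tau σ 0 y - k)) * σ y =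
        Real.exp (l * (tau σ 0 y - k)) * (l * σ y) := by ring
    rw [e]
    exact ((hd.sub_const k).const_mul l).exp
  · refine (h.intervalIntegrable ha hb).continuousOn_mul ?_
    rw [uIcc_of_le hab]
    exact continuousOn_const.mul hc

theorem opticalPath_left (h : CrossSection m σ) {x : ℝ} (hx : x ∈ Icc (0 : ℝ) 1) :
    OpticalPath m 0 x (fun y => tau σ y x) σ := by
  have h0 : (0 : ℝ) ∈ Icc (0 : ℝ) 1 := by simp
  have hsub : Icc 0 x ⊆ Icc 0 1 := Icc_subset_Icc le_rfl hx.2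
  have heq : EqOn (fun y => tau σ y x) (fun y => tau σ 0 x - tau σ 0 y) (Icc 0 x) :=
    fun y hy => h.tau_eq (hsub hy) hx
  refine ⟨hx.1, h.pos, (continuousOn_const.sub (h.continuousOn_tau.mono hsub)).congr heq,
    fun y hy => h.tau_nonneg (hsub hy) hx hy.2, h.intervalIntegrable h0 hx,
    fun y hy => h.lower y (hsub hy), tau σ 0 x, h.tau_nonneg h0 hx hx.1, fun l _ => ?_⟩
  have h1 := h.integral_exp h0 hx hx.1 l (tau σ 0 x)
  have h2 : tau σ 0 0 = 0 := intervalIntegral.integral_same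
  rw [h2, sub_self, mul_zero, Real.exp_zero, zero_sub, mul_neg] at h1
  rw [← h1]
  refine intervalIntegral.integral_congr fun y hy => ?_
  rw [uIcc_of_le hx.1] at hy
  have := heq hy
  simp only at this ⊢
  rw [this, ← mul_neg, neg_sub]

theorem opticalPath_right (h : CrossSection m σ) {x : ℝ} (hx : x ∈ Icc (0 : ℝ) 1) :
    OpticalPath m x 1 (fun y => tau σ x y) σ := by
  have h0 : (1 : ℝ) ∈ Icc (0 : ℝ) 1 := by simp
  have hsub : Icc x 1 ⊆ Icc 0 1 := Icc_subset_Icc hx.1 le_rfl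
  have heq : EqOn (fun y => tau σ x y) (fun y => tau σ 0 y - tau σ 0 x) (Icc x 1) :=
    fun y hy => h.tau_eq hx (hsub hy)
  refine ⟨hx.2, h.pos, ((h.continuousOn_tau.mono hsub).sub continuousOn_const).congr heq,
    fun y hy => h.tau_nonneg hx (hsub hy) hy.1, h.intervalIntegrable hx h0,
    fun y hy => h.lower y (hsub hy), tau σ x 1, h.tau_nonneg hx h0 hx.2, fun l _ => ?_⟩
  have h1 := h.integral_exp hx h0 hx.2 (-l) (tau σ 0 x)
  rw [sub_self, mul_zero, Real.exp_zero, ← h.tau_eq hx h0] at h1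
  rw [← neg_sub, neg_mul l] at h1
  simp only [neg_mul, intervalIntegral.integral_neg, neg_sub] at h1
  rw [← neg_sub, ← h1, neg_neg]
  refine intervalIntegral.integral_congr fun y hy => ?_
  rw [uIcc_of_le hx.2] at hy
  have := heq hy
  simp only at this ⊢
  rw [this]

end CrossSection

/-! ### The transport operators on L_∞. -/

theorem solOp_of_pos {σ g : ℝ → ℝ} {μ : ℝ} (hμ : 0 < μ) (x : ℝ) :
    solOp σ μ g x = rayOp (fun y => tau σ y x) 0 x g μ := by
  rw [solOp, if_pos hμ, rayOp]
  simp only [tau]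
  simp_rw [fun y => intervalIntegral.integral_symm (μ := volume) (f := σ) y x, mul_neg]

theorem solOp_neg_of_pos {σ g : ℝ → ℝ} {μ : ℝ} (hμ : 0 < μ) (x : ℝ) :
    solOp σ (-μ) g x = rayOp (fun y => tau σ x y) x 1 g μ := by
  rw [solOp, if_neg (by linarith), if_neg (by linarith), rayOp, inv_neg, neg_neg]
  simp only [neg_mul]

theorem LInf.ae_abs_le (g : LInf) : ∀ᵐ y, y ∈ Icc (0 : ℝ) 1 → |g y| ≤ ‖g‖ := by
  rw [← ae_restrict_iff' measurableSet_Icc]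
  have hfin : eLpNorm g ∞ (volume.restrict (Icc (0 : ℝ) 1)) ≠ ∞ := Lp.eLpNorm_ne_top g
  filter_upwards [ae_le_eLpNormEssSup (f := g) (μ := volume.restrict (Icc (0 : ℝ) 1))] with y hy
  rw [Lp.norm_def, ← Real.norm_eq_abs, ← toReal_enorm]
  refine ENNReal.toReal_mono hfin ?_
  rwa [eLpNorm_exponent_top]

theorem LInf.integrableOn (g : LInf) : IntegrableOn g (Icc (0 : ℝ) 1) :=
  (Lp.memLp g).integrable le_top

theorem LInf.intervalIntegrable (g : LInf) {x y : ℝ} (hx : x ∈ Icc (0 : ℝ) 1)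
    (hy : y ∈ Icc (0 : ℝ) 1) : IntervalIntegrable g volume x y := by
  have : IntervalIntegrable g volume 0 1 := by
    rw [intervalIntegrable_iff_integrableOn_Icc_of_le zero_le_one]
    exact LInf.integrableOn g
  refine this.mono_set ?_
  rw [uIcc_of_le zero_le_one]
  exact uIcc_subset_Icc hx hy

namespace CrossSection

variable {m : ℝ} {σ : ℝ → ℝ}

theorem logLipschitz_left (h : CrossSection m σ) (g : LInf) {x : ℝ} (hx : x ∈ Icc (0 : ℝ) 1) :
    LogLipschitz (2 * (‖g‖ / m)) (rayOp (fun y => tau σ y x) 0 x g) :=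
  (h.opticalPath_left hx).logLipschitz_rayOp (norm_nonneg g)
    (LInf.intervalIntegrable g (by simp) hx) (by
      filter_upwards [LInf.ae_abs_le g] with y hy hyI
      exact hy ⟨hyI.1.le, hyI.2.trans hx.2⟩)

theorem logLipschitz_right (h : CrossSection m σ) (g : LInf) {x : ℝ} (hx : x ∈ Icc (0 : ℝ) 1) :
    LogLipschitz (2 * (‖g‖ / m)) (rayOp (fun y => tau σ x y) x 1 g) :=
  (h.opticalPath_right hx).logLipschitz_rayOp (norm_nonneg g)
    (LInf.intervalIntegrable g hx (by simp)) (by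
      filter_upwards [LInf.ae_abs_le g] with y hy hyI
      exact hy ⟨hx.1.trans hyI.1.le, hyI.2⟩)

theorem abs_solOp_le (h : CrossSection m σ) (g : LInf) {x : ℝ} (hx : x ∈ Icc (0 : ℝ) 1)
    {μ : ℝ} (hμ : μ ≠ 0) : |solOp σ μ g x| ≤ ‖g‖ / m := by
  rcases hμ.lt_or_gt with hneg | hpos
  · have hμ' : 0 < -μ := by linarith
    rw [← neg_neg μ, solOp_neg_of_pos hμ']
    refine (h.opticalPath_right hx).abs_rayOp_le (norm_nonneg g) ?_ hμ'
    filter_upwards [LInf.ae_abs_le g] with y hy hyI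
    exact hy ⟨hx.1.trans hyI.1.le, hyI.2⟩
  · rw [solOp_of_pos hpos]
    refine (h.opticalPath_left hx).abs_rayOp_le (norm_nonneg g) ?_ hpos
    filter_upwards [LInf.ae_abs_le g] with y hy hyI
    exact hy ⟨hyI.1.le, hyI.2.trans hx.2⟩

theorem intervalIntegrable_exp_mul (h : CrossSection m σ) (g : LInf) (c : ℝ) {x y : ℝ}
    (hx : x ∈ Icc (0 : ℝ) 1) (hy : y ∈ Icc (0 : ℝ) 1) :
    IntervalIntegrable (fun s => Real.exp (c * tau σ 0 s) * g s) volume x y := by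
  refine (LInf.intervalIntegrable g hx hy).continuousOn_mul ?_
  exact Real.continuous_exp.comp_continuousOn
    (continuousOn_const.mul (h.continuousOn_tau.mono (uIcc_subset_Icc hx hy)))

theorem integral_exp_tau_mul (h : CrossSection m σ) (g : ℝ → ℝ) (c : ℝ) {x a b : ℝ}
    (hx : x ∈ Icc (0 : ℝ) 1) (ha : a ∈ Icc (0 : ℝ) 1) (hb : b ∈ Icc (0 : ℝ) 1) :
    ∫ y in a..b, Real.exp (c * tau σ x y) * g y =
      Real.exp (-(c * tau σ 0 x)) * ∫ y in a..b, Real.exp (c * tau σ 0 y) * g y := by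
  rw [← intervalIntegral.integral_const_mul]
  refine intervalIntegral.integral_congr fun y hy => ?_
  rw [h.tau_eq hx (uIcc_subset_Icc ha hb hy), ← mul_assoc, ← Real.exp_add]
  ring_nf

/-- For `μ ≠ 0` the solution operator is an integral operator with a factorized kernel. -/
theorem solOp_eq (h : CrossSection m σ) (g : ℝ → ℝ) {μ : ℝ} (hμ : μ ≠ 0) {x : ℝ}
    (hx : x ∈ Icc (0 : ℝ) 1) : solOp σ μ g x =
      Real.exp (-(μ⁻¹ * tau σ 0 x)) * (μ⁻¹ * ∫ y in (if 0 < μ then 0 else 1)..x,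
        Real.exp (μ⁻¹ * tau σ 0 y) * g y) := by
  rw [solOp, if_neg hμ]
  split_ifs with hpos
  · rw [h.integral_exp_tau_mul g _ hx (by simp) hx]
    ring
  · rw [h.integral_exp_tau_mul g _ hx hx (by simp), intervalIntegral.integral_symm 1 x]
    ring

/-- The representative of a sum agrees with the sum of representatives only almost everywhere. This
is harmless under an integral, but not at μ = 0, where the operator acts pointwise. -/
theorem solOp_add (h : CrossSection m σ) (f g : LInf) {μ : ℝ} (hμ : μ ≠ 0) {x : ℝ}
    (hx : x ∈ Icc (0 : ℝ) 1) :
    solOp σ μ (f + g : LInf) x = solOp σ μ f x + solOp σ μ g x := by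
  have h0 : (if 0 < μ then (0 : ℝ) else 1) ∈ Icc (0 : ℝ) 1 := by split_ifs <;> simp
  rw [h.solOp_eq _ hμ hx, h.solOp_eq _ hμ hx, h.solOp_eq _ hμ hx, ← mul_add, ← mul_add,
    ← intervalIntegral.integral_add (h.intervalIntegrable_exp_mul f _ h0 hx)
      (h.intervalIntegrable_exp_mul g _ h0 hx)]
  congr 2
  refine intervalIntegral.integral_congr_ae ?_
  filter_upwards [(ae_restrict_iff' measurableSet_Icc).mp (Lp.coeFn_add f g)] with y hy hyI
  rw [hy (uIcc_subset_Icc h0 hx (uIoc_subset_uIcc hyI)), Pi.add_apply, mul_add]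

theorem solOp_smul (h : CrossSection m σ) (c : ℝ) (g : LInf) {μ : ℝ} (hμ : μ ≠ 0) {x : ℝ}
    (hx : x ∈ Icc (0 : ℝ) 1) :
    solOp σ μ (c • g : LInf) x = c * solOp σ μ g x := by
  have h0 : (if 0 < μ then (0 : ℝ) else 1) ∈ Icc (0 : ℝ) 1 := by split_ifs <;> simp
  rw [h.solOp_eq _ hμ hx, h.solOp_eq _ hμ hx, mul_left_comm c, mul_left_comm c,
    ← intervalIntegral.integral_const_mul c]
  congr 2
  refine intervalIntegral.integral_congr_ae ?_
  filter_upwards [(ae_restrict_iff' measurableSet_Icc).mp (Lp.coeFn_smul c g)] with y hy hyI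
  rw [hy (uIcc_subset_Icc h0 hx (uIoc_subset_uIcc hyI)), Pi.smul_apply, smul_eq_mul, mul_left_comm]

theorem continuous_solOp (h : CrossSection m σ) (g : LInf) {μ : ℝ} (hμ : μ ≠ 0) :
    Continuous fun x : unitInterval => solOp σ μ g x := by
  have h0 : (if 0 < μ then (0 : ℝ) else 1) ∈ Icc (0 : ℝ) 1 := by split_ifs <;> simp
  have hc : ContinuousOn (fun x => solOp σ μ g x) (Icc 0 1) := by
    refine ContinuousOn.congr ?_ fun x hx => h.solOp_eq g hμ hx
    refine (Real.continuous_exp.comp_continuousOn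
      (continuousOn_const.mul h.continuousOn_tau).neg).mul (continuousOn_const.mul ?_)
    have := intervalIntegral.continuousOn_primitive_interval' (μ := volume)
      (h.intervalIntegrable_exp_mul g μ⁻¹ (x := 0) (y := 1) (by simp) (by simp))
      (a := if 0 < μ then (0 : ℝ) else 1) (by rwa [uIcc_of_le zero_le_one])
    rwa [uIcc_of_le zero_le_one] at this
  exact hc.comp_continuous continuous_subtype_val fun x => x.2

theorem intervalIntegrable_solOp_pos (h : CrossSection m σ) (g : LInf) {x : ℝ}
    (hx : x ∈ Icc (0 : ℝ) 1) : IntervalIntegrable (fun μ => solOp σ μ g x) volume 0 1 := by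
  refine (h.logLipschitz_left g hx).intervalIntegrable.congr fun μ hμ => ?_
  rw [uIoc_of_le zero_le_one] at hμ
  exact (solOp_of_pos hμ.1 x).symm

theorem intervalIntegrable_solOp_comp_neg (h : CrossSection m σ) (g : LInf) {x : ℝ}
    (hx : x ∈ Icc (0 : ℝ) 1) : IntervalIntegrable (fun μ => solOp σ (-μ) g x) volume 0 1 := by
  refine (h.logLipschitz_right g hx).intervalIntegrable.congr fun μ hμ => ?_
  rw [uIoc_of_le zero_le_one] at hμ
  exact (solOp_neg_of_pos hμ.1 x).symm

theorem intervalIntegrable_solOp_neg (h : CrossSection m σ) (g : LInf) {x : ℝ}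
    (hx : x ∈ Icc (0 : ℝ) 1) : IntervalIntegrable (fun μ => solOp σ μ g x) volume (-1) 0 := by
  have := ((h.intervalIntegrable_solOp_comp_neg g hx).comp_sub_left 0).symm
  simpa using this

theorem intervalIntegrable_solOp (h : CrossSection m σ) (g : LInf) {x : ℝ}
    (hx : x ∈ Icc (0 : ℝ) 1) : IntervalIntegrable (fun μ => solOp σ μ g x) volume (-1) 1 :=
  (h.intervalIntegrable_solOp_neg g hx).trans (h.intervalIntegrable_solOp_pos g hx)

theorem avgOp_eq (h : CrossSection m σ) (g : LInf) {x : ℝ} (hx : x ∈ Icc (0 : ℝ) 1) :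
    avgOp σ g x = 1 / 2 * ((∫ μ in (0 : ℝ)..1, rayOp (fun y => tau σ y x) 0 x g μ) +
      ∫ μ in (0 : ℝ)..1, rayOp (fun y => tau σ x y) x 1 g μ) := by
  have h1 : ∫ μ in (0 : ℝ)..1, solOp σ μ g x =
      ∫ μ in (0 : ℝ)..1, rayOp (fun y => tau σ y x) 0 x g μ := by
    refine intervalIntegral.integral_congr_ae (ae_of_all _ fun μ hμ => ?_)
    rw [uIoc_of_le zero_le_one] at hμ
    exact solOp_of_pos hμ.1 x
  have h2 : ∫ μ in (0 : ℝ)..1, solOp σ (-μ) g x =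
      ∫ μ in (0 : ℝ)..1, rayOp (fun y => tau σ x y) x 1 g μ := by
    refine intervalIntegral.integral_congr_ae (ae_of_all _ fun μ hμ => ?_)
    rw [uIoc_of_le zero_le_one] at hμ
    exact solOp_neg_of_pos hμ.1 x
  rw [intervalIntegral.integral_comp_neg (fun μ => solOp σ μ g x), neg_zero] at h2
  rw [avgOp, ← intervalIntegral.integral_add_adjacent_intervals
    (h.intervalIntegrable_solOp_neg g hx) (h.intervalIntegrable_solOp_pos g hx), h1, h2, add_comm]

end CrossSection

theorem quadOp_eq (σ : ℝ → ℝ) (N : ℕ) (g : ℝ → ℝ) (x : ℝ) :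
    quadOp σ N g x = 1 / 2 *
      ((∑ t ∈ gaussNodes N, gaussWeight N t * rayOp (fun y => tau σ y x) 0 x g t) +
      ∑ t ∈ gaussNodes N, gaussWeight N t * rayOp (fun y => tau σ x y) x 1 g t) := by
  have hpos : ∀ t ∈ gaussNodes N, 0 < t := fun t ht => ((gaussNodes_spec N).1 t ht).1
  have hdisj : Disjoint (gaussNodes N) ((gaussNodes N).image fun t => -t) := by
    rw [Finset.disjoint_left]
    intro t ht ht'
    obtain ⟨s, hs, rfl⟩ := Finset.mem_image.mp ht'
    linarith [hpos _ ht, hpos s hs]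
  rw [quadOp, doubleGaussNodes, Finset.sum_union hdisj,
    Finset.sum_image fun _ _ _ _ h => neg_injective h]
  congr 2
  · refine Finset.sum_congr rfl fun t ht => ?_
    rw [doubleGaussWeight, abs_of_pos (hpos t ht), solOp_of_pos (hpos t ht)]
  · refine Finset.sum_congr rfl fun t ht => ?_
    rw [doubleGaussWeight, abs_neg, abs_of_pos (hpos t ht), solOp_neg_of_pos (hpos t ht)]

theorem ne_zero_of_mem_doubleGaussNodes {N : ℕ} {t : ℝ} (ht : t ∈ doubleGaussNodes N) :
    t ≠ 0 := by
  rcases Finset.mem_union.mp ht with ht | ht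
  · exact ((gaussNodes_spec N).1 t ht).1.ne'
  · obtain ⟨s, hs, rfl⟩ := Finset.mem_image.mp ht
    exact neg_ne_zero.mpr ((gaussNodes_spec N).1 s hs).1.ne'

/-! ### Boundedness into C[0,1] and the error estimate. -/

/-- A bounded linear operator into `C[0,1]` from its pointwise values. -/
theorem exists_continuousLinearMap (Φ : LInf → ℝ → ℝ) (C : ℝ)
    (hadd : ∀ f g, ∀ x ∈ Icc (0 : ℝ) 1, Φ (f + g) x = Φ f x + Φ g x)
    (hsmul : ∀ (c : ℝ) (g), ∀ x ∈ Icc (0 : ℝ) 1, Φ (c • g) x = c * Φ g x)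
    (hcont : ∀ g, Continuous fun x : unitInterval => Φ g x) (hC : 0 ≤ C)
    (hbound : ∀ g, ∀ x ∈ Icc (0 : ℝ) 1, |Φ g x| ≤ C * ‖g‖) :
    ∃ K : LInf →L[ℝ] C(unitInterval, ℝ), ∀ (g : LInf) (x : unitInterval), K g x = Φ g x := by
  let K : LInf →ₗ[ℝ] C(unitInterval, ℝ) :=
    { toFun := fun g => ⟨fun x => Φ g x, hcont g⟩
      map_add' := fun f g => ContinuousMap.ext fun x => hadd f g x x.2
      map_smul' := fun c g => ContinuousMap.ext fun x => hsmul c g x x.2 }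
  refine ⟨K.mkContinuous C fun g => ?_, fun g x => rfl⟩
  rw [ContinuousMap.norm_le _ (mul_nonneg hC (norm_nonneg g))]
  exact fun x => hbound g x x.2

namespace CrossSection

variable {m : ℝ} {σ : ℝ → ℝ}

theorem exists_avgOp (h : CrossSection m σ) : ∃ K : LInf →L[ℝ] C(unitInterval, ℝ),
    ∀ (g : LInf) (x : unitInterval), K g x = avgOp σ g x := by
  -- The ill-behaved direction μ = 0 is a null set of the angular integral.
  have hne : ∀ᵐ μ : ℝ, μ ≠ 0 := Measure.ae_ne volume 0
  refine exists_continuousLinearMap (fun g x => avgOp σ g x) m⁻¹ (fun f g x hx => ?_)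
    (fun c g x hx => ?_) (fun g => ?_) (inv_nonneg.mpr h.pos.le) (fun g x hx => ?_)
  · simp only [avgOp]
    rw [← mul_add, ← intervalIntegral.integral_add (h.intervalIntegrable_solOp f hx)
      (h.intervalIntegrable_solOp g hx)]
    congr 1
    refine intervalIntegral.integral_congr_ae ?_
    filter_upwards [hne] with μ hμ _
    exact h.solOp_add f g hμ hx
  · simp only [avgOp]
    rw [mul_left_comm, ← intervalIntegral.integral_const_mul c]
    congr 1
    refine intervalIntegral.integral_congr_ae ?_
    filter_upwards [hne] with μ hμ _
    exact h.solOp_smul c g hμ hx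
  · refine continuous_const.mul (intervalIntegral.continuous_of_dominated_interval
      (bound := fun _ => ‖g‖ / m) (fun x => ?_) (fun x => ?_) intervalIntegrable_const ?_)
    · exact (h.intervalIntegrable_solOp g x.2).aestronglyMeasurable_restrict_uIoc
    · filter_upwards [hne] with μ hμ _
      exact h.abs_solOp_le g x.2 hμ
    · filter_upwards [hne] with μ hμ _
      exact h.continuous_solOp g hμ
  · have h1 : |∫ μ in (-1 : ℝ)..1, solOp σ μ g x| ≤ ∫ μ in (-1 : ℝ)..1, ‖g‖ / m := by
      refine intervalIntegral.norm_integral_le_of_norm_le (f := fun μ => solOp σ μ g x)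
        (by norm_num) ?_ intervalIntegrable_const
      filter_upwards [hne] with μ hμ _
      exact h.abs_solOp_le g hx hμ
    rw [intervalIntegral.integral_const, smul_eq_mul] at h1
    rw [avgOp, abs_mul, abs_of_pos (one_half_pos)]
    calc _ ≤ 1 / 2 * ((1 - -1) * (‖g‖ / m)) := mul_le_mul_of_nonneg_left h1 one_half_pos.le
      _ = m⁻¹ * ‖g‖ := by ring

theorem exists_quadOp (h : CrossSection m σ) (N : ℕ) : ∃ K : LInf →L[ℝ] C(unitInterval, ℝ),
    ∀ (g : LInf) (x : unitInterval), K g x = quadOp σ N g x := by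
  refine exists_continuousLinearMap (fun g x => quadOp σ N g x)
    (1 / 2 * ∑ t ∈ doubleGaussNodes N, |doubleGaussWeight N t| * m⁻¹) (fun f g x hx => ?_)
    (fun c g x hx => ?_) (fun g => ?_) ?_ (fun g x hx => ?_)
  · simp only [quadOp]
    rw [← mul_add, ← Finset.sum_add_distrib]
    congr 1
    refine Finset.sum_congr rfl fun t ht => ?_
    rw [h.solOp_add f g (ne_zero_of_mem_doubleGaussNodes ht) hx, mul_add]
  · simp only [quadOp]
    rw [mul_left_comm, Finset.mul_sum _ _ c]
    congr 1
    refine Finset.sum_congr rfl fun t ht => ?_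
    rw [h.solOp_smul c g (ne_zero_of_mem_doubleGaussNodes ht) hx, mul_left_comm]
  · exact continuous_const.mul (continuous_finsetSum _ fun t ht => continuous_const.mul
      (h.continuous_solOp g (ne_zero_of_mem_doubleGaussNodes ht)))
  · have := h.pos
    positivity
  · simp only [quadOp]
    rw [abs_mul, abs_of_pos (one_half_pos), mul_assoc]
    refine mul_le_mul_of_nonneg_left ?_ one_half_pos.le
    refine (Finset.abs_sum_le_sum_abs _ _).trans ?_
    rw [Finset.sum_mul]
    refine Finset.sum_le_sum fun t ht => ?_
    rw [abs_mul, mul_assoc, inv_mul_eq_div]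
    exact mul_le_mul_of_nonneg_left (h.abs_solOp_le g hx (ne_zero_of_mem_doubleGaussNodes ht))
      (abs_nonneg _)

theorem abs_avgOp_sub_quadOp_le (h : CrossSection m σ) {N : ℕ} (hN : 1 ≤ N) (g : LInf) {x : ℝ}
    (hx : x ∈ Icc (0 : ℝ) 1) :
    |avgOp σ g x - quadOp σ N g x| ≤ 16 * m⁻¹ * (N : ℝ)⁻¹ * ‖g‖ := by
  have h1 := (h.logLipschitz_left g hx).gauss_error hN
  have h2 := (h.logLipschitz_right g hx).gauss_error hN
  -- The Gauss error 8A/N with A = 2‖g‖/m; each of the two directions contributes it with weight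
  -- 1/2.
  have e : 8 * (2 * (‖g‖ / m)) * (N : ℝ)⁻¹ = 16 * m⁻¹ * (N : ℝ)⁻¹ * ‖g‖ := by ring
  rw [e] at h1 h2
  rw [h.avgOp_eq g hx, quadOp_eq]
  rw [abs_le] at h1 h2 ⊢
  constructor <;> linarith [h1.1, h1.2, h2.1, h2.2]

end CrossSection

end SlabTransport


/-- There is an absolute constant `c` such that, for every admissible total cross-section `σ` and
every `N ≥ 1`, the operators `K` and `K^N` map `L_∞` boundedly into `C[0,1]` and
`‖K - K^N‖ ≤ c σ_min⁻¹ N⁻¹` in the operator norm. -/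
theorem theorem4p2 :
    ∃ c : ℝ, 0 < c ∧
      ∀ (n : ℕ) (p : Fin (n + 1) → ℝ) (η : ℝ≥0) (σ : ℝ → ℝ) (N : ℕ),
        SlabTransport.IsPartition p → 0 < η → η ≤ 1 →
        SlabTransport.PiecewiseHolder p η σ → 0 < SlabTransport.sigmaMin σ → 1 ≤ N →
        ∃ K KN : SlabTransport.LInf →L[ℝ] C(unitInterval, ℝ),
          (∀ (g : SlabTransport.LInf) (x : unitInterval),
            K g x = SlabTransport.avgOp σ g x) ∧
          (∀ (g : SlabTransport.LInf) (x : unitInterval),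
            KN g x = SlabTransport.quadOp σ N g x) ∧
          ‖K - KN‖ ≤ c * (SlabTransport.sigmaMin σ)⁻¹ * (N : ℝ)⁻¹ := by
  refine ⟨16, by norm_num, fun n p η σ N hp hη _ hσ hpos hN => ?_⟩
  have h := hσ.crossSection hp hη hpos
  obtain ⟨K, hK⟩ := h.exists_avgOp
  obtain ⟨KN, hKN⟩ := h.exists_quadOp N
  have hc : 0 ≤ 16 * (SlabTransport.sigmaMin σ)⁻¹ * (N : ℝ)⁻¹ := by positivity
  refine ⟨K, KN, hK, hKN, ContinuousLinearMap.opNorm_le_bound _ hc fun g => ?_⟩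
  rw [ContinuousMap.norm_le _ (mul_nonneg hc (norm_nonneg g))]
  intro x
  rw [sub_apply, ContinuousMap.sub_apply, hK, hKN, Real.norm_eq_abs]
  exact h.abs_avgOp_sub_quadOp_le hN g x.2
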